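/- Let $\mathcal H=L^2(\mathbb R;\mathbb C)$, with $Q$ the multiplication by $x$ and $P=-i\,\frac{d}{dx}$, and let $W(q,p)=e^{iqp/2}e^{-iqP}e^{ipQ}$ be the Weyl operators, so that $(e^{-iqP}\psi)(x)=\psi(x-q)$ and $(e^{ipQ}\psi)(x)=e^{ipx}\psi(x)$. A state is a positive operator on $\mathcal H$ with trace one. An observable is a normalized positive operator measure $\mathsf E:\mathcal B(\mathbb R^2)\to\mathcal L(\mathcal H)$ on the Borel sets of $\mathbb R^2$. Its statistics in a state $\rho$ are $\mathsf E_\rho(Z)=\operatorname{tr}[\rho\,\mathsf E(Z)]$. Two observables $\mathsf E,\mathsf F$ are informationally equivalent if, for all states $\rho_1,\rho_2$, $\mathsf E_{\rho_1}=\mathsf E_{\rho_2}$ if and only if $\mathsf F_{\rho_1}=\mathsf F_{\rho_2}$; $\mathsf E$ is informationally complete if, for all states $\rho_1,\rho_2$, $\mathsf E_{\rho_1}=\mathsf E_{\rho_2}$ implies $\rho_1=\rho_2$. Let $\theta\in(-\pi,0)\cup(0,\pi)$, let $f_\theta:\mathbb R^2\to\mathbb R^2$ be the linear bijection $f_\theta(q,p)=(q,\,q\cos\theta+p\sin\theta)$,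 and put $W_\theta(q,p)=W(f_\theta^{-1}(q,p))$. Let $S$ be a positive operator on $\mathcal H$ with trace one, and for Borel sets $Z\subseteq\mathbb R^2$ put $$\mathsf G^S(Z)=\frac1{2\pi}\int_Z W(q,p)\,S\,W(q,p)^*\,dq\,dp,\qquad \mathsf G^S_\theta(Z)=\frac1{2\pi|\sin\theta|}\int_Z W_\theta(q,p)\,S\,W_\theta(q,p)^*\,dq\,dp .$$ Then these integrals exist in the weak sense (every matrix element of the integrand is integrable over $Z$, and the integrals of the matrix elements are those of a bounded operator), $\mathsf G^S$ and $\mathsf G^S_\theta$ are observables, and $$\mathsf G^S_\theta(Z)=\mathsf G^S(f_\theta^{-1}(Z))\qquad\text{for every Borel set } Z\subseteq\mathbb R^2 .$$ Moreover, $\mathsf G^S$ and $\mathsf G^S_\theta$ are informationally equivalent, and $\mathsf G^S_\theta$ is informationally complete if and only if the support of the function $(q,p)\mapsto\operatorname{tr}[S\,W(q,p)]$ (the closure of the set where it does not vanish) is all of $\mathbb R^2$. -/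

import Mathlib

open MeasureTheory

noncomputable section

namespace TiltedPhaseSpace

/-- The Hilbert space `L²(ℝ; ℂ)` of one mode, in the coordinate representation. -/
abbrev H : Type := Lp ℂ 2 (volume : Measure ℝ)

/-! ### Trace, states -/

/-- The index set of a fixed orthonormal (Hilbert) basis of `H`. -/
def basisIndex : Set H := Classical.choose (exists_hilbertBasis ℂ H)

/-- A fixed orthonormal (Hilbert) basis of `H`. -/
def basis : HilbertBasis basisIndex ℂ H :=
  Classical.choose (Classical.choose_spec (exists_hilbertBasis ℂ H))

/-- The trace `∑ₙ ⟨eₙ, A eₙ⟩`. It is meant for trace class operators, where the series converges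
absolutely and its sum does not depend on the orthonormal basis. -/
def tr (A : H →L[ℂ] H) : ℂ := ∑' i, inner ℂ (basis i) (A (basis i))

/-- States: positive operators with unit trace. (The sum of a divergent series is `0` by
convention, so `tr ρ = 1` includes convergence, i.e. that the positive operator `ρ` is trace
class.) -/
def IsState (ρ : H →L[ℂ] H) : Prop := ρ.IsPositive ∧ tr ρ = 1

/-! ### Observables with outcome space `ℝ²` -/

/-- Normalized positive operator measures on the Borel sets of `ℝ²`. Values on sets that are not
Borel play no role. -/
structure IsObservable (E : Set (ℝ × ℝ) → (H →L[ℂ] H)) : Prop where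
  isPositive : ∀ Z, MeasurableSet Z → (E Z).IsPositive
  univ : E Set.univ = 1
  iUnion : ∀ Z : ℕ → Set (ℝ × ℝ), (∀ n, MeasurableSet (Z n)) →
    Pairwise (Function.onFun Disjoint Z) → ∀ φ ψ : H,
      HasSum (fun n => inner ℂ φ (E (Z n) ψ)) (inner ℂ φ (E (⋃ n, Z n) ψ))

/-- `E_ρ₁ = E_ρ₂`, where `E_ρ(Z) = tr[ρ E(Z)]`: the states `ρ₁` and `ρ₂` give the same measurement
outcome statistics for `E`. -/
def SameStatistics (E : Set (ℝ × ℝ) → (H →L[ℂ] H)) (ρ₁ ρ₂ : H →L[ℂ] H) : Prop :=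
  ∀ Z, MeasurableSet Z → tr (ρ₁ * E Z) = tr (ρ₂ * E Z)

/-- `E` and `F` distinguish exactly the same states. -/
def InformationallyEquivalent (E F : Set (ℝ × ℝ) → (H →L[ℂ] H)) : Prop :=
  ∀ ρ₁ ρ₂, IsState ρ₁ → IsState ρ₂ → (SameStatistics E ρ₁ ρ₂ ↔ SameStatistics F ρ₁ ρ₂)

/-- The measurement outcome statistics of `E` determine the state uniquely. -/
def InformationallyComplete (E : Set (ℝ × ℝ) → (H →L[ℂ] H)) : Prop :=
  ∀ ρ₁ ρ₂, IsState ρ₁ → IsState ρ₂ → SameStatistics E ρ₁ ρ₂ → ρ₁ = ρ₂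

/-! ### Weyl operators -/

/-- `e^{-iqP}`, where `P = -i d/dx`: the translation `(e^{-iqP} ψ)(x) = ψ(x - q)`. -/
def translation (q : ℝ) : H →L[ℂ] H :=
  (Lp.compMeasurePreservingₗᵢ ℂ (fun x : ℝ => x - q)
    (measurePreserving_sub_right volume q)).toContinuousLinearMap

theorem memLp_modulation (p : ℝ) (ψ : H) :
    MemLp (fun x : ℝ => Complex.exp (Complex.I * p * x) * ψ x) 2 volume := by
  refine (Lp.memLp ψ).of_le ?_ (Filter.Eventually.of_forall fun x => ?_)
  · exact (Continuous.aestronglyMeasurable (by fun_prop)).mul (Lp.aestronglyMeasurable ψ)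
  · rw [norm_mul, mul_assoc, ← Complex.ofReal_mul, mul_comm Complex.I,
      Complex.norm_exp_ofReal_mul_I, one_mul]

/-- `e^{ipQ}`: the multiplication operator `(e^{ipQ} ψ)(x) = e^{ipx} ψ(x)`. -/
def modulation (p : ℝ) : H →L[ℂ] H :=
  LinearMap.mkContinuous
    { toFun := fun ψ => (memLp_modulation p ψ).toLp _
      map_add' := fun ψ φ => by
        rw [← MemLp.toLp_add]
        refine MemLp.toLp_congr _ _ ?_
        filter_upwards [Lp.coeFn_add ψ φ] with x hx
        rw [Pi.add_apply, hx, Pi.add_apply, mul_add]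
      map_smul' := fun c ψ => by
        rw [RingHom.id_apply, ← MemLp.toLp_const_smul]
        refine MemLp.toLp_congr _ _ ?_
        filter_upwards [Lp.coeFn_smul c ψ] with x hx
        simp [hx, mul_left_comm] }
    1
    (fun ψ => by
      rw [one_mul]
      refine Lp.norm_le_norm_of_ae_le ?_
      filter_upwards [MemLp.coeFn_toLp (memLp_modulation p ψ)] with x hx
      refine (congrArg norm hx).le.trans ?_
      rw [norm_mul, mul_assoc, ← Complex.ofReal_mul, mul_comm Complex.I,
        Complex.norm_exp_ofReal_mul_I, one_mul])

/-- The Weyl operator `W(q,p) = e^{iqp/2} e^{-iqP} e^{ipQ}`. -/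
def weyl (x : ℝ × ℝ) : H →L[ℂ] H :=
  Complex.exp (Complex.I * (x.1 * x.2 / 2)) • (translation x.1 * modulation x.2)

/-! ### The tilting map and the tilted Weyl operators -/

theorem sin_ne_zero {θ : ℝ} (hθ : θ ∈ Set.Ioo (-Real.pi) 0 ∪ Set.Ioo 0 Real.pi) :
    Real.sin θ ≠ 0 := by
  rcases hθ with h | h
  · exact (Real.sin_neg_of_neg_of_neg_pi_lt h.2 h.1).ne
  · exact (Real.sin_pos_of_pos_of_lt_pi h.1 h.2).ne'

/-- The linear bijection `f_θ(q,p) = (q, q cos θ + p sin θ)` of `ℝ²`. -/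
def tilt (θ : ℝ) (hθ : θ ∈ Set.Ioo (-Real.pi) 0 ∪ Set.Ioo 0 Real.pi) :
    (ℝ × ℝ) ≃ₗ[ℝ] (ℝ × ℝ) where
  toFun x := (x.1, x.1 * Real.cos θ + x.2 * Real.sin θ)
  map_add' x y := by ext <;> simp; ring
  map_smul' c x := by ext <;> simp; ring
  invFun y := (y.1, (y.2 - y.1 * Real.cos θ) / Real.sin θ)
  left_inv x := by
    have := sin_ne_zero hθ
    ext <;> simp [this]
  right_inv y := by
    have := sin_ne_zero hθ
    ext <;> simp [this]

/-- `W_θ(q,p) = W(f_θ⁻¹(q,p))`. -/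
def tiltedWeyl (θ : ℝ) (hθ : θ ∈ Set.Ioo (-Real.pi) 0 ∪ Set.Ioo 0 Real.pi) (x : ℝ × ℝ) :
    H →L[ℂ] H :=
  weyl ((tilt θ hθ).symm x)

/-! ### Operator integrals and the observables -/

/-- `T = ∫_Z F(q,p) dq dp` in the weak sense: every matrix element of `F` is integrable over `Z`,
and its integral is the matrix element of `T`. -/
def HasWeakIntegral (F : ℝ × ℝ → (H →L[ℂ] H)) (Z : Set (ℝ × ℝ)) (T : H →L[ℂ] H) : Prop :=
  ∀ φ ψ : H, IntegrableOn (fun x => inner ℂ φ (F x ψ)) Z volume ∧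
    inner ℂ φ (T ψ) = ∫ x in Z, inner ℂ φ (F x ψ)

open Classical in
/-- The weak integral `∫_Z F(q,p) dq dp` (there is at most one); `0` if it does not exist. -/
def weakIntegral (F : ℝ × ℝ → (H →L[ℂ] H)) (Z : Set (ℝ × ℝ)) : H →L[ℂ] H :=
  if h : ∃ T, HasWeakIntegral F Z T then Classical.choose h else 0

/-- The integrand `W(q,p) S W(q,p)^*` of `G^S`. -/
def orbit (S : H →L[ℂ] H) (x : ℝ × ℝ) : H →L[ℂ] H :=
  weyl x * S * ContinuousLinearMap.adjoint (weyl x)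

/-- The integrand `W_θ(q,p) S W_θ(q,p)^*` of `G^S_θ`. -/
def tiltedOrbit (θ : ℝ) (hθ : θ ∈ Set.Ioo (-Real.pi) 0 ∪ Set.Ioo 0 Real.pi) (S : H →L[ℂ] H)
    (x : ℝ × ℝ) : H →L[ℂ] H :=
  tiltedWeyl θ hθ x * S * ContinuousLinearMap.adjoint (tiltedWeyl θ hθ x)

/-- `G^S(Z) = (1 / 2π) ∫_Z W(q,p) S W(q,p)^* dq dp`. -/
def G (S : H →L[ℂ] H) (Z : Set (ℝ × ℝ)) : H →L[ℂ] H :=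
  ((1 / (2 * Real.pi) : ℝ) : ℂ) • weakIntegral (orbit S) Z

/-- `G^S_θ(Z) = (1 / (2π |sin θ|)) ∫_Z W_θ(q,p) S W_θ(q,p)^* dq dp`. -/
def tiltedG (θ : ℝ) (hθ : θ ∈ Set.Ioo (-Real.pi) 0 ∪ Set.Ioo 0 Real.pi) (S : H →L[ℂ] H)
    (Z : Set (ℝ × ℝ)) : H →L[ℂ] H :=
  ((1 / (2 * Real.pi * |Real.sin θ|) : ℝ) : ℂ) • weakIntegral (tiltedOrbit θ hθ S) Z

end TiltedPhaseSpace

end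

/-!
A state is a mixture `∑ i, |r i⟩⟨r i|` with `∑ i, ‖r i‖² = 1`, for instance with `r i` the image of
the `i`-th basis vector under the square root of the state. This reduces operator identities to
the orthogonality relations
`∫ ⟨f, W(x) g⟩ ⟨W(x) g', f'⟩ dx = 2π ⟨f, f'⟩ ⟨g', g⟩`,
which are Plancherel's theorem in the momentum variable. They give the existence of the integrals
and the normalization of `G S`, and also that the Weyl transform `y ↦ tr (ρ W(y))` determines `ρ`.

Since `W(y) W(x) W(y)* = exp(i ω(x, y)) W(x)`, with `ω` the symplectic form, the symplectic Fourier
transform of the outcome density of `G S` in the state `ρ` is `y ↦ tr (ρ W(y)) tr (S W(-y))`. Hence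
`G S` determines `tr (ρ W(y))` wherever `tr (S W(-y)) ≠ 0`, and everywhere, by continuity, if these
`y` are dense. If `tr (S W(y))` vanishes near `y₀`, take a real integrable function whose symplectic
Fourier transform is nonzero at `y₀` and supported near `±y₀`: the random displacements of a pure
state with densities proportional to its positive and its negative part are different states with
the same outcome density.

A linear change of variables turns the tilted observable into `G S` with relabelled outcomes, and a
relabelling by a measurable bijection distinguishes the same states.
-/

noncomputable section

namespace TiltedPhaseSpace

open Complex ComplexConjugate
open scoped ComplexOrder

/-! ### Hilbert spaces -/

section HilbertSpace

variable {𝕜 E ι X : Type*} [RCLike 𝕜] [NormedAddCommGroup E]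

theorem countable_of_orthonormal [InnerProductSpace 𝕜 E] [TopologicalSpace.SeparableSpace E]
    {v : ι → E} (hv : Orthonormal 𝕜 v) : Countable ι := by
  have hdisj : Set.univ.PairwiseDisjoint fun i => Metric.ball (v i) (1 / 2) := by
    intro i _ j _ hij
    have h : ‖v i - v j‖ ^ 2 = 2 := by
      rw [@norm_sub_sq 𝕜, hv.1, hv.1, hv.2 hij]
      norm_num
    refine Metric.ball_disjoint_ball ?_
    rw [dist_eq_norm]
    nlinarith [norm_nonneg (v i - v j)]
  exact Set.countable_univ_iff.1 <| hdisj.countable_of_isOpen (fun _ _ => Metric.isOpen_ball)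
    fun i _ => ⟨v i, by simp⟩

theorem hasSum_norm_inner_sq [InnerProductSpace 𝕜 E] (b : HilbertBasis ι 𝕜 E) (φ : E) :
    HasSum (fun i => ‖inner 𝕜 φ (b i)‖ ^ 2) (‖φ‖ ^ 2) := by
  have h := (b.hasSum_inner_mul_inner φ φ).mapL (RCLike.reCLM : 𝕜 →L[ℝ] ℝ)
  simp only [RCLike.reCLM_apply, inner_mul_symm_re_eq_norm, inner_self_eq_norm_sq, norm_mul,
    norm_inner_symm (b _), ← sq] at h
  exact h

theorem continuous_of_continuous_norm_of_continuous_inner [InnerProductSpace 𝕜 E]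
    [TopologicalSpace X] {f : X → E} (hn : Continuous fun x => ‖f x‖)
    (hi : ∀ x₀, Continuous fun x => inner 𝕜 (f x₀) (f x)) : Continuous f := by
  refine continuous_iff_continuousAt.2 fun x₀ => ?_
  have e (x : X) : ‖f x - f x₀‖ =
      √(‖f x₀‖ ^ 2 - 2 * RCLike.re (inner 𝕜 (f x₀) (f x)) + ‖f x‖ ^ 2) := by
    rw [← @norm_sub_sq 𝕜, norm_sub_rev, Real.sqrt_sq (norm_nonneg _)]
  have hc : Continuous fun x => ‖f x - f x₀‖ := by
    simp only [e]
    have := RCLike.continuous_re.comp (hi x₀)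
    fun_prop
  exact tendsto_iff_norm_sub_tendsto_zero.2 (hc.tendsto' x₀ 0 (by simp))

variable [InnerProductSpace ℂ E]

theorem exists_norm_eq_one_inner_apply_ne_zero {T : E →ₗ[ℂ] E} (hT : T ≠ 0) :
    ∃ φ, ‖φ‖ = 1 ∧ inner ℂ φ (T φ) ≠ 0 := by
  obtain ⟨ψ, hψ⟩ : ∃ ψ, inner ℂ ψ (T ψ) ≠ 0 := by
    by_contra! h
    exact hT ((inner_map_self_eq_zero T).1 fun ψ => by rw [← inner_conj_symm, h, map_zero])
  have hψ0 : ‖ψ‖ ≠ 0 := norm_ne_zero_iff.2 fun h => hψ (by simp [h])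
  refine ⟨((‖ψ‖⁻¹ : ℝ) : ℂ) • ψ, by simp [norm_smul, hψ0], ?_⟩
  simp [hψ, hψ0]

theorem isPositive_of_forall_inner_nonneg {T : E →L[ℂ] E} (h : ∀ φ, 0 ≤ inner ℂ φ (T φ)) :
    T.IsPositive := by
  refine (ContinuousLinearMap.isPositive_iff_complex T).2 fun φ => ?_
  rw [← inner_conj_symm]
  obtain ⟨c, hc, hφ⟩ := RCLike.nonneg_iff_exists_ofReal.1 (h φ)
  simpa [← hφ] using hc

theorem integral_inner_apply_of_self {α : Type*} [MeasurableSpace α] {μ : Measure α}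
    {T : α → E →ₗ[ℂ] E} {C : E →ₗ[ℂ] E}
    (hi : ∀ φ, Integrable (fun x => inner ℂ (T x φ) φ) μ)
    (h : ∀ φ, ∫ x, inner ℂ (T x φ) φ ∂μ = inner ℂ (C φ) φ) (φ ψ : E) :
    ∫ x, inner ℂ (T x φ) ψ ∂μ = inner ℂ (C φ) ψ := by
  simp only [fun x => inner_map_polarization' (T x) φ ψ]
  rw [inner_map_polarization' C, integral_div, integral_add, integral_sub, integral_sub,
    integral_const_mul, integral_const_mul, h, h, h, h]
  all_goals
    first
    | exact hi _
    | exact (hi _).const_mul _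
    | exact (hi _).sub (hi _)
    | exact ((hi _).sub (hi _)).sub ((hi _).const_mul _)

end HilbertSpace

/-! ### Mixtures of vectors -/

section Mixture

open InnerProductSpace

variable {E α : Type*} [NormedAddCommGroup E] [InnerProductSpace ℂ E] [MeasurableSpace α]
  {μ : Measure α} {r : α → E}

/-- The mixture `∫ |r t⟩⟨r t| dμ(t)` of a square integrable family of vectors. The counting measure
gives decompositions of states into vectors, and measures on phase space give smeared states. -/
def mixture (μ : Measure α) (r : α → E) : E →L[ℂ] E := ∫ t, rankOne ℂ (r t) (r t) ∂μ

theorem integrable_rankOne_self (hr : MemLp r 2 μ) :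
    Integrable (fun t => rankOne ℂ (r t) (r t)) μ := by
  have hc : Continuous fun v : E => rankOne ℂ v v :=
    ((ContinuousLinearMap.smulRightL ℂ E E).continuous.comp (innerSL ℂ).continuous).clm_apply
      continuous_id
  refine (hr.integrable_norm_pow two_ne_zero).mono' (hc.comp_aestronglyMeasurable hr.1) ?_
  exact .of_forall fun t => by rw [norm_rankOne, sq]

variable [CompleteSpace E]

theorem inner_mixture (hr : MemLp r 2 μ) (φ ψ : E) :
    inner ℂ φ (mixture μ r ψ) = ∫ t, inner ℂ φ (r t) * inner ℂ (r t) ψ ∂μ := by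
  have hi := integrable_rankOne_self hr
  rw [mixture, ContinuousLinearMap.integral_apply hi,
    ← integral_inner (hi.apply_continuousLinearMap ψ)]
  simp only [rankOne_apply, inner_smul_right, mul_comm]

theorem isPositive_mixture (hr : MemLp r 2 μ) : (mixture μ r).IsPositive := by
  refine isPositive_of_forall_inner_nonneg fun φ => ?_
  rw [inner_mixture hr]
  refine integral_nonneg fun t => ?_
  rw [← inner_conj_symm (r t), Complex.mul_conj]
  exact Complex.zero_le_real.2 (Complex.normSq_nonneg _)

theorem hasSum_inner_mixture_mul {ι : Type*} [Countable ι] (b : HilbertBasis ι ℂ E)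
    (hr : MemLp r 2 μ) (A : E →L[ℂ] E) :
    HasSum (fun i => inner ℂ (b i) ((mixture μ r * A) (b i)))
      (∫ t, inner ℂ (r t) (A (r t)) ∂μ) := by
  set B := ContinuousLinearMap.adjoint A
  have hB : MemLp (fun t => B (r t)) 2 μ := B.comp_memLp' hr
  have hbound (t : α) : HasSum (fun i => ‖inner ℂ (B (r t)) (b i)‖ ^ 2 + ‖inner ℂ (r t) (b i)‖ ^ 2)
      (‖B (r t)‖ ^ 2 + ‖r t‖ ^ 2) :=
    (hasSum_norm_inner_sq b _).add (hasSum_norm_inner_sq b _)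
  simp only [mul_apply_eq_comp, inner_mixture hr, ← ContinuousLinearMap.adjoint_inner_left A]
  refine hasSum_integral_of_dominated_convergence
    (fun i t => ‖inner ℂ (B (r t)) (b i)‖ ^ 2 + ‖inner ℂ (r t) (b i)‖ ^ 2)
    (fun i => (aestronglyMeasurable_const.inner hr.1).mul (hB.1.inner aestronglyMeasurable_const))
    (fun i => .of_forall fun t => ?_) (.of_forall fun t => (hbound t).summable) ?_
    (.of_forall fun t => ?_)
  · rw [norm_mul, norm_inner_symm (b i)]
    nlinarith [sq_nonneg (‖inner ℂ (r t) (b i)‖ - ‖inner ℂ (B (r t)) (b i)‖),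
      sq_nonneg ‖inner ℂ (r t) (b i)‖, sq_nonneg ‖inner ℂ (B (r t)) (b i)‖]
  · simp only [(hbound _).tsum_eq]
    exact (hB.integrable_norm_pow two_ne_zero).add (hr.integrable_norm_pow two_ne_zero)
  · exact (b.hasSum_inner_mul_inner (B (r t)) (r t)).congr_fun fun i => mul_comm _ _

theorem exists_mixture_count_eq {ι : Type*} [Countable ι] [MeasurableSpace ι]
    [DiscreteMeasurableSpace ι] (b : HilbertBasis ι ℂ E) {T : E →L[ℂ] E} (hT : T.IsPositive)
    (hsum : Summable fun i => inner ℂ (b i) (T (b i))) :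
    ∃ r : ι → E, MemLp r 2 Measure.count ∧ mixture Measure.count r = T := by
  set R := CFC.sqrt T
  have hR (φ ψ : E) : inner ℂ φ (R ψ) = inner ℂ (R φ) ψ := by
    rw [← ContinuousLinearMap.adjoint_inner_left,
      (IsSelfAdjoint.of_nonneg (CFC.sqrt_nonneg T)).adjoint_eq]
  have hRT (φ : E) : R (R φ) = T φ := by
    rw [← mul_apply_eq_comp, CFC.sqrt_mul_sqrt_self T
      ((ContinuousLinearMap.nonneg_iff_isPositive T).2 hT)]
  have hr : MemLp (fun i => R (b i)) 2 Measure.count := by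
    rw [memLp_two_iff_integrable_sq_norm .of_discrete, integrable_count_iff]
    convert hsum.norm using 2 with i
    rw [← hRT, hR, inner_self_eq_norm_sq_to_K]
    simp
  refine ⟨fun i => R (b i), hr, ContinuousLinearMap.ext fun ψ => ext_inner_left ℂ fun φ => ?_⟩
  have hint : Integrable (fun i => inner ℂ φ (R (b i)) * inner ℂ (R (b i)) ψ) Measure.count :=
    (hr.const_inner φ).integrable_mul (hr.inner_const ψ)
  rw [inner_mixture hr, integral_countable hint, ← hRT, hR,
    ← (b.hasSum_inner_mul_inner (R φ) (R ψ)).tsum_eq]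
  simp [hR]

end Mixture

/-! ### States as mixtures -/

section State

instance : SecondCountableTopology H :=
  haveI : Fact ((2 : ENNReal) ≠ ⊤) := ⟨ENNReal.ofNat_ne_top⟩
  inferInstance

instance : Countable basisIndex := countable_of_orthonormal basis.orthonormal

instance : MeasurableSpace basisIndex := ⊤

instance : DiscreteMeasurableSpace basisIndex := ⟨fun _ => trivial⟩

variable {α : Type*} [MeasurableSpace α] {μ : Measure α} {r : α → H}

theorem tr_mixture_mul (hr : MemLp r 2 μ) (A : H →L[ℂ] H) :
    tr (mixture μ r * A) = ∫ t, inner ℂ (r t) (A (r t)) ∂μ :=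
  (hasSum_inner_mixture_mul basis hr A).tsum_eq

theorem tr_mixture (hr : MemLp r 2 μ) : tr (mixture μ r) = (∫ t, ‖r t‖ ^ 2 ∂μ : ℝ) := by
  rw [← mul_one (mixture μ r), tr_mixture_mul hr, ← integral_complex_ofReal]
  simp [inner_self_eq_norm_sq_to_K]

theorem isState_mixture_iff (hr : MemLp r 2 μ) :
    IsState (mixture μ r) ↔ ∫ t, ‖r t‖ ^ 2 ∂μ = 1 := by
  rw [IsState, tr_mixture hr, and_iff_right (isPositive_mixture hr), ofReal_eq_one]

theorem IsState.exists_mixture_eq {ρ : H →L[ℂ] H} (hρ : IsState ρ) :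
    ∃ r : basisIndex → H, MemLp r 2 Measure.count ∧ mixture Measure.count r = ρ := by
  refine exists_mixture_count_eq basis hρ.1 ?_
  by_contra h
  exact zero_ne_one ((tsum_eq_zero_of_not_summable h).symm.trans hρ.2)

end State

/-! ### Weyl operators -/

theorem coeFn_translation (q : ℝ) (ψ : H) : translation q ψ =ᵐ[volume] fun x => ψ (x - q) :=
  Lp.coeFn_compMeasurePreserving ψ (measurePreserving_sub_right volume q)

theorem coeFn_modulation (p : ℝ) (ψ : H) :
    modulation p ψ =ᵐ[volume] fun x => exp (I * p * x) * ψ x :=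
  MemLp.coeFn_toLp (memLp_modulation p ψ)

theorem ae_eq_comp_sub {β : Type*} {f g : ℝ → β} (h : f =ᵐ[volume] g) (q : ℝ) :
    (fun x => f (x - q)) =ᵐ[volume] fun x => g (x - q) :=
  (measurePreserving_sub_right volume q).quasiMeasurePreserving.ae_eq_comp h

theorem translation_mul_translation (a b : ℝ) :
    translation a * translation b = translation (a + b) := by
  ext1 ψ
  refine Lp.ext ?_
  filter_upwards [coeFn_translation a (translation b ψ), coeFn_translation (a + b) ψ,
    ae_eq_comp_sub (coeFn_translation b ψ) a] with x h₁ h₂ h₃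
  rw [mul_apply_eq_comp, h₁, h₂, h₃, sub_sub]

theorem modulation_mul_modulation (a b : ℝ) :
    modulation a * modulation b = modulation (a + b) := by
  ext1 ψ
  refine Lp.ext ?_
  filter_upwards [coeFn_modulation a (modulation b ψ), coeFn_modulation (a + b) ψ,
    coeFn_modulation b ψ] with x h₁ h₂ h₃
  rw [mul_apply_eq_comp, h₁, h₂, h₃, ← mul_assoc, ← Complex.exp_add]
  push_cast
  ring_nf

theorem modulation_mul_translation (p q : ℝ) :
    modulation p * translation q = exp (I * (p * q)) • (translation q * modulation p) := by
  ext1 ψ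
  refine Lp.ext ?_
  filter_upwards [coeFn_modulation p (translation q ψ), coeFn_translation q ψ,
    Lp.coeFn_smul (exp (I * (p * q))) (translation q (modulation p ψ)),
    coeFn_translation q (modulation p ψ), ae_eq_comp_sub (coeFn_modulation p ψ) q]
    with x h₁ h₂ h₃ h₄ h₅
  rw [mul_apply_eq_comp, h₁, h₂, smul_apply, mul_apply_eq_comp, h₃,
    Pi.smul_apply, h₄, h₅, smul_eq_mul, ← mul_assoc, ← Complex.exp_add]
  push_cast
  ring_nf

theorem norm_translation_apply (q : ℝ) (ψ : H) : ‖translation q ψ‖ = ‖ψ‖ :=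
  LinearIsometry.norm_map _ ψ

theorem norm_modulation_apply (p : ℝ) (ψ : H) : ‖modulation p ψ‖ = ‖ψ‖ := by
  have h : ∀ᵐ x : ℝ, ‖modulation p ψ x‖ = ‖ψ x‖ := by
    filter_upwards [coeFn_modulation p ψ] with x hx
    rw [hx, norm_mul, mul_assoc, ← ofReal_mul, norm_exp_I_mul_ofReal, one_mul]
  exact le_antisymm (Lp.norm_le_norm_of_ae_le (h.mono fun x hx => hx.le))
    (Lp.norm_le_norm_of_ae_le (h.mono fun x hx => hx.ge))

theorem norm_weyl_apply (x : ℝ × ℝ) (ψ : H) : ‖weyl x ψ‖ = ‖ψ‖ := by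
  rw [weyl, smul_apply, norm_smul, mul_apply_eq_comp,
    norm_translation_apply, norm_modulation_apply]
  have := norm_exp_I_mul_ofReal (x.1 * x.2 / 2)
  push_cast at this
  rw [this, one_mul]

theorem inner_weyl_weyl (x : ℝ × ℝ) (φ ψ : H) :
    inner ℂ (weyl x φ) (weyl x ψ) = inner ℂ φ ψ :=
  (LinearMap.norm_map_iff_inner_map_map (weyl x)).1 (norm_weyl_apply x) φ ψ

theorem modulation_zero : modulation 0 = 1 := by
  ext1 ψ
  refine Lp.ext ?_
  filter_upwards [coeFn_modulation 0 ψ] with x hx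
  rw [hx]
  simp

theorem translation_zero : translation 0 = 1 := by
  ext1 ψ
  refine Lp.ext ?_
  filter_upwards [coeFn_translation 0 ψ] with x hx
  rw [hx]
  simp

theorem weyl_zero : weyl 0 = 1 := by
  simp [weyl, modulation_zero, translation_zero]

theorem weyl_mul_weyl (x y : ℝ × ℝ) :
    weyl x * weyl y = exp (I * ((x.2 * y.1 - x.1 * y.2) / 2)) • weyl (x + y) := by
  have h : translation x.1 * modulation x.2 * (translation y.1 * modulation y.2) =
      exp (I * (x.2 * y.1)) • (translation (x.1 + y.1) * modulation (x.2 + y.2)) := by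
    calc translation x.1 * modulation x.2 * (translation y.1 * modulation y.2)
        = translation x.1 * (modulation x.2 * translation y.1) * modulation y.2 := by
          simp only [mul_assoc]
      _ = _ := by
          rw [modulation_mul_translation, mul_smul_comm, smul_mul_assoc,
            ← mul_assoc (translation x.1), translation_mul_translation, mul_assoc,
            modulation_mul_modulation]
  simp only [weyl]
  rw [smul_mul_smul_comm, h, smul_smul, smul_smul, ← Complex.exp_add, ← Complex.exp_add,
    ← Complex.exp_add, Prod.fst_add, Prod.snd_add]
  push_cast
  ring_nf

theorem weyl_mul_weyl_neg (x : ℝ × ℝ) : weyl x * weyl (-x) = 1 := by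
  rw [weyl_mul_weyl, add_neg_cancel, weyl_zero]
  simp [mul_comm]

theorem weyl_weyl_neg_apply (x : ℝ × ℝ) (ψ : H) : weyl x (weyl (-x) ψ) = ψ := by
  rw [← mul_apply_eq_comp, weyl_mul_weyl_neg, one_apply_eq_self]

theorem inner_weyl_left (x : ℝ × ℝ) (φ ψ : H) :
    inner ℂ (weyl x φ) ψ = inner ℂ φ (weyl (-x) ψ) := by
  rw [← inner_weyl_weyl x φ, weyl_weyl_neg_apply]

theorem inner_weyl_right (x : ℝ × ℝ) (φ ψ : H) :
    inner ℂ φ (weyl x ψ) = inner ℂ (weyl (-x) φ) ψ := by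
  rw [inner_weyl_left, neg_neg]

theorem adjoint_weyl (x : ℝ × ℝ) : ContinuousLinearMap.adjoint (weyl x) = weyl (-x) := by
  refine ((ContinuousLinearMap.eq_adjoint_iff _ _).2 fun φ ψ => ?_).symm
  rw [inner_weyl_left, neg_neg]

/-- The symplectic character `e^{i (x₁ y₂ - x₂ y₁)}`. -/
def phase (x y : ℝ × ℝ) : ℂ := exp (I * ((x.1 * y.2 - x.2 * y.1 : ℝ) : ℂ))

theorem norm_phase (x y : ℝ × ℝ) : ‖phase x y‖ = 1 := norm_exp_I_mul_ofReal _

theorem phase_zero (x : ℝ × ℝ) : phase x 0 = 1 := by simp [phase]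

theorem continuous_phase (y : ℝ × ℝ) : Continuous fun x => phase x y := by
  unfold phase
  fun_prop

theorem conj_phase (x y : ℝ × ℝ) : conj (phase x y) = phase x (-y) := by
  rw [phase, phase, ← Complex.exp_conj, map_mul, conj_I, conj_ofReal]
  congr 1
  simp only [Prod.fst_neg, Prod.snd_neg]
  push_cast
  ring

theorem weyl_conj_weyl_apply (x y : ℝ × ℝ) (ψ : H) :
    weyl y (weyl x (weyl (-y) ψ)) = phase x y • weyl x ψ := by
  have h : weyl y * weyl x = phase x y • (weyl x * weyl y) := by
    rw [weyl_mul_weyl, weyl_mul_weyl, smul_smul, phase, ← Complex.exp_add, add_comm y x]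
    congr 2
    push_cast
    ring
  have h₂ := congrArg (fun T : H →L[ℂ] H => T (weyl (-y) ψ)) h
  simpa only [mul_apply_eq_comp, smul_apply, weyl_weyl_neg_apply] using h₂

/-! ### Strong continuity -/

theorem continuous_modulation_apply (ψ : H) : Continuous fun p => modulation p ψ := by
  refine continuous_of_continuous_norm_of_continuous_inner (𝕜 := ℂ)
    (by simp only [norm_modulation_apply, continuous_const]) fun p₀ => ?_
  have e (p : ℝ) : inner ℂ (modulation p₀ ψ) (modulation p ψ) =
      ∫ x : ℝ, inner ℂ (exp (I * p₀ * x) * ψ x) (exp (I * p * x) * ψ x) := by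
    rw [L2.inner_def]
    refine integral_congr_ae ?_
    filter_upwards [coeFn_modulation p₀ ψ, coeFn_modulation p ψ] with x h₀ h
    rw [h₀, h]
  simp only [e]
  refine continuous_of_dominated (bound := fun x => ‖ψ x‖ ^ 2)
    (fun p => (memLp_modulation p₀ ψ).1.inner (memLp_modulation p ψ).1)
    (fun p => .of_forall fun x => (norm_inner_le_norm _ _).trans_eq ?_)
    ((Lp.memLp ψ).integrable_norm_pow two_ne_zero) (.of_forall fun x => by fun_prop)
  rw [norm_mul, norm_mul, mul_assoc I, mul_assoc I, ← ofReal_mul, ← ofReal_mul,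
    norm_exp_I_mul_ofReal, norm_exp_I_mul_ofReal]
  ring

theorem continuous_translation_modulation_apply (ψ : H) :
    Continuous fun x : ℝ × ℝ => translation x.1 (modulation x.2 ψ) := by
  have hg : Continuous fun x : ℝ × ℝ => (⟨fun t => t - x.1, by fun_prop⟩ : C(ℝ, ℝ)) := by
    refine ContinuousMap.continuous_of_continuous_uncurry _ ?_
    simp only [Function.uncurry_def, ContinuousMap.coe_mk]
    fun_prop
  exact ((continuous_modulation_apply ψ).comp continuous_snd).compMeasurePreservingLp hg
    (fun x => measurePreserving_sub_right volume x.1) ENNReal.ofNat_ne_top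

theorem continuous_weyl_apply (ψ : H) : Continuous fun x => weyl x ψ := by
  have h : Continuous fun x : ℝ × ℝ => exp (I * (x.1 * x.2 / 2)) := by fun_prop
  exact h.smul (continuous_translation_modulation_apply ψ)

theorem continuous_inner_weyl (φ ψ : H) : Continuous fun x => inner ℂ φ (weyl x ψ) :=
  continuous_const.inner (continuous_weyl_apply ψ)

theorem continuous_uncurry_weyl_apply : Continuous fun z : (ℝ × ℝ) × H => weyl z.1 z.2 :=
  continuous_prod_of_continuous_lipschitzWith' _ 1
    (fun x => LipschitzWith.of_dist_le_mul fun φ ψ => by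
      simp [dist_eq_norm, ← map_sub, norm_weyl_apply])
    continuous_weyl_apply

theorem norm_inner_weyl_le (x : ℝ × ℝ) (φ ψ : H) :
    ‖inner ℂ φ (weyl x ψ)‖ ≤ ‖φ‖ * ‖ψ‖ := by
  rw [← norm_weyl_apply x ψ]
  exact norm_inner_le_norm _ _

/-! ### Plancherel's theorem on `L¹ ∩ L²` -/

section Plancherel

open FourierTransform SchwartzMap

theorem eLpNorm_two_sq {α E : Type*} [MeasurableSpace α] {μ : Measure α} [NormedAddCommGroup E]
    (f : α → E) : eLpNorm f 2 μ ^ 2 = ∫⁻ x, ‖f x‖ₑ ^ 2 ∂μ := by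
  simpa using eLpNorm_nnreal_pow_eq_lintegral (μ := μ) (f := f) (p := 2) two_ne_zero

variable {V E : Type*} [NormedAddCommGroup V] [InnerProductSpace ℝ V] [FiniteDimensional ℝ V]
  [MeasurableSpace V] [BorelSpace V] [NormedAddCommGroup E] [InnerProductSpace ℂ E]

theorem continuous_fourier {f : V → E} (hf : Integrable f) : Continuous (𝓕 f) :=
  VectorFourier.fourierIntegral_continuous Real.continuous_fourierChar
    (by exact continuous_inner) hf

variable [CompleteSpace E]

theorem integral_fourier_smul_eq (v : 𝓢(V, ℂ)) {f : V → E} (hf : Integrable f) :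
    ∫ x, (𝓕 v) x • f x = ∫ x, v x • 𝓕 f x := by
  simpa using! (VectorFourier.integral_fourierIntegral_smul_eq_flip (L := innerₗ V)
    Real.continuous_fourierChar continuous_inner v.integrable hf)

theorem coeFn_fourier_toLp {f : V → E} (h₁ : Integrable f) (h₂ : MemLp f 2) :
    (𝓕 (h₂.toLp f) : Lp E 2 (volume : Measure V)) =ᵐ[volume] 𝓕 f := by
  set g : Lp E 2 (volume : Measure V) := 𝓕 (h₂.toLp f) with hg
  refine ae_eq_of_integral_contDiff_smul_eq ((Lp.memLp g).locallyIntegrable one_le_two)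
    (continuous_fourier h₁).locallyIntegrable fun u hu hcu => ?_
  have hcu' : HasCompactSupport (Complex.ofRealCLM ∘ u) := hcu.comp_left rfl
  set v : 𝓢(V, ℂ) := hcu'.toSchwartzMap (Complex.ofRealCLM.contDiff.comp hu)
  have hvu (x : V) (e : E) : v x • e = u x • e := Complex.coe_smul (u x) e
  have hgv : ∫ x, v x • g x = ∫ x, 𝓕 v x • f x := by
    have := congrArg (fun T : TemperedDistribution V E => T v)
      (Lp.fourier_toTemperedDistribution_eq (h₂.toLp f))
    simp only [TemperedDistribution.fourier_apply, Lp.toTemperedDistribution_apply] at this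
    rw [hg, ← this]
    refine integral_congr_ae ?_
    filter_upwards [h₂.coeFn_toLp] with x hx
    rw [hx]
  simpa only [← hvu, integral_fourier_smul_eq v h₁] using hgv

theorem lintegral_enorm_fourier_sq {f : V → E} (h₁ : Integrable f) (h₂ : MemLp f 2) :
    ∫⁻ ξ, ‖𝓕 f ξ‖ₑ ^ 2 = ∫⁻ x, ‖f x‖ₑ ^ 2 := by
  have h : ‖(𝓕 (h₂.toLp f) : Lp E 2 (volume : Measure V))‖ₑ = ‖h₂.toLp f‖ₑ := by
    rw [← ofReal_norm, ← ofReal_norm, Lp.norm_fourier_eq]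
  rw [← eLpNorm_two_sq, ← eLpNorm_two_sq, ← eLpNorm_congr_ae (coeFn_fourier_toLp h₁ h₂),
    ← Lp.enorm_def, h, Lp.enorm_def, eLpNorm_congr_ae h₂.coeFn_toLp]

end Plancherel

/-! ### Orthogonality relations -/

section Orthogonality

open FourierTransform InnerProductSpace

theorem coeFn_weyl (x : ℝ × ℝ) (ψ : H) :
    weyl x ψ =ᵐ[volume] fun t => exp (I * ((x.2 * t - x.1 * x.2 / 2 : ℝ) : ℂ)) * ψ (t - x.1) := by
  filter_upwards [Lp.coeFn_smul (exp (I * (x.1 * x.2 / 2))) (translation x.1 (modulation x.2 ψ)),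
    coeFn_translation x.1 (modulation x.2 ψ), ae_eq_comp_sub (coeFn_modulation x.2 ψ) x.1]
    with t h_smul h_translation h_modulation
  rw [weyl, smul_apply, mul_apply_eq_comp, h_smul, Pi.smul_apply, h_translation, h_modulation,
    smul_eq_mul, ← mul_assoc, ← Complex.exp_add]
  push_cast
  ring_nf

theorem inner_weyl_eq_fourier (q p : ℝ) (φ χ : H) :
    inner ℂ φ (weyl (q, p) χ) = exp (I * (-(q * p / 2) : ℝ)) *
      𝓕 (fun x => conj (φ x) * χ (x - q)) (-(2 * Real.pi)⁻¹ * p) := by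
  rw [Real.fourier_real_eq_integral_exp_smul, L2.inner_def, ← integral_const_mul]
  refine integral_congr_ae ?_
  filter_upwards [coeFn_weyl (q, p) χ] with x hx
  have hp : -2 * Real.pi * x * (-(2 * Real.pi)⁻¹ * p) = p * x := by field_simp
  rw [hx, hp, RCLike.inner_apply, smul_eq_mul, sub_eq_add_neg (p * x), ofReal_add, mul_add,
    Complex.exp_add, mul_comm (ofReal _) I]
  ring

theorem enorm_inner_weyl (q p : ℝ) (φ χ : H) :
    ‖inner ℂ φ (weyl (q, p) χ)‖ₑ =
      ‖𝓕 (fun x => conj (φ x) * χ (x - q)) (-(2 * Real.pi)⁻¹ * p)‖ₑ := by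
  rw [inner_weyl_eq_fourier, enorm_mul, ← ofReal_norm (exp _), norm_exp_I_mul_ofReal,
    ENNReal.ofReal_one, one_mul]

theorem lintegral_comp_const_mul (f : ℝ → ENNReal) {a : ℝ} (ha : a ≠ 0) :
    ∫⁻ p, f (a * p) = ENNReal.ofReal |a⁻¹| * ∫⁻ p, f p := by
  rw [← (measurableEmbedding_mulLeft₀ ha).lintegral_map, Real.map_volume_mul_left ha,
    lintegral_smul_measure, smul_eq_mul]

theorem measurable_enorm_conj_mul_comp_sub_sq (φ χ : H) :
    Measurable (Function.uncurry fun q x : ℝ => ‖conj (φ x) * χ (x - q)‖ₑ ^ 2) := by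
  have hφ : Measurable fun z : ℝ × ℝ => conj (φ z.2) :=
    Complex.continuous_conj.measurable.comp
      ((Lp.stronglyMeasurable φ).measurable.comp measurable_snd)
  have hχ : Measurable fun z : ℝ × ℝ => χ (z.2 - z.1) :=
    (Lp.stronglyMeasurable χ).measurable.comp (measurable_snd.sub measurable_fst)
  exact (hφ.mul hχ).enorm.pow_const 2

theorem lintegral_lintegral_enorm_conj_mul_comp_sub_sq (φ χ : H) :
    ∫⁻ q, ∫⁻ x, ‖conj (φ x) * χ (x - q)‖ₑ ^ 2 = ‖φ‖ₑ ^ 2 * ‖χ‖ₑ ^ 2 := by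
  have : Measurable (χ : ℝ → ℂ) := (Lp.stronglyMeasurable χ).measurable
  rw [lintegral_lintegral_swap (measurable_enorm_conj_mul_comp_sub_sq φ χ).aemeasurable]
  have e (x : ℝ) : ∫⁻ q, ‖conj (φ x) * χ (x - q)‖ₑ ^ 2 = ‖φ x‖ₑ ^ 2 * ‖χ‖ₑ ^ 2 := by
    simp only [enorm_mul, mul_pow, RCLike.enorm_conj]
    rw [lintegral_const_mul _ (by fun_prop),
      lintegral_sub_left_eq_self (fun q => ‖χ q‖ₑ ^ 2), Lp.enorm_def, eLpNorm_two_sq]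
  simp only [e]
  rw [lintegral_mul_const' _ _ (by finiteness), ← eLpNorm_two_sq, ← Lp.enorm_def]

theorem integrable_conj_mul_comp_sub (q : ℝ) (φ χ : H) :
    Integrable fun x => conj (φ x) * χ (x - q) :=
  (Lp.memLp φ).star.integrable_mul
    ((Lp.memLp χ).comp_measurePreserving (measurePreserving_sub_right volume q))

theorem lintegral_enorm_inner_weyl_mk_sq {q : ℝ} {φ χ : H}
    (h : MemLp (fun x => conj (φ x) * χ (x - q)) 2) :
    ∫⁻ p, ‖inner ℂ φ (weyl (q, p) χ)‖ₑ ^ 2 =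
      ENNReal.ofReal (2 * Real.pi) * ∫⁻ x, ‖conj (φ x) * χ (x - q)‖ₑ ^ 2 := by
  simp only [enorm_inner_weyl]
  rw [lintegral_comp_const_mul (fun ξ => ‖𝓕 (fun x => conj (φ x) * χ (x - q)) ξ‖ₑ ^ 2)
    (by simp [Real.pi_ne_zero]), lintegral_enorm_fourier_sq (integrable_conj_mul_comp_sub q φ χ) h,
    inv_neg, inv_inv, abs_neg, abs_of_pos Real.two_pi_pos]

theorem lintegral_enorm_inner_weyl_sq (φ χ : H) :
    ∫⁻ x, ‖inner ℂ φ (weyl x χ)‖ₑ ^ 2 =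
      ENNReal.ofReal (2 * Real.pi) * (‖φ‖ₑ ^ 2 * ‖χ‖ₑ ^ 2) := by
  have hm := (measurable_enorm_conj_mul_comp_sub_sq φ χ).lintegral_prod_right (ν := volume)
  have hfin : ∀ᵐ q : ℝ, ∫⁻ x, ‖conj (φ x) * χ (x - q)‖ₑ ^ 2 < ⊤ := by
    refine ae_lt_top hm ?_
    rw [lintegral_lintegral_enorm_conj_mul_comp_sub_sq]
    finiteness
  have hmeas := (continuous_inner_weyl φ χ).enorm.measurable.pow_const 2
  rw [Measure.volume_eq_prod ℝ ℝ, lintegral_prod _ (by exact hmeas.aemeasurable),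
    ← lintegral_lintegral_enorm_conj_mul_comp_sub_sq, ← lintegral_const_mul _ hm]
  refine lintegral_congr_ae ?_
  filter_upwards [hfin] with q hq
  rw [← eLpNorm_two_sq, ENNReal.pow_lt_top_iff] at hq
  exact lintegral_enorm_inner_weyl_mk_sq
    ⟨(integrable_conj_mul_comp_sub q φ χ).1, hq.resolve_right two_ne_zero⟩

theorem memLp_inner_weyl (φ χ : H) : MemLp (fun x => inner ℂ φ (weyl x χ)) 2 := by
  refine ⟨(continuous_inner_weyl φ χ).aestronglyMeasurable, ?_⟩
  refine (ENNReal.pow_lt_top_iff (n := 2)).1 ?_ |>.resolve_right two_ne_zero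
  rw [eLpNorm_two_sq, lintegral_enorm_inner_weyl_sq]
  finiteness

theorem memLp_inner_weyl_left (φ χ : H) : MemLp (fun x => inner ℂ (weyl x χ) φ) 2 := by
  simpa only [Pi.star_def, RCLike.star_def, inner_conj_symm] using (memLp_inner_weyl φ χ).star

theorem integral_norm_inner_weyl_sq (φ χ : H) :
    ∫ x, ‖inner ℂ φ (weyl x χ)‖ ^ 2 = 2 * Real.pi * (‖φ‖ ^ 2 * ‖χ‖ ^ 2) := by
  rw [integral_eq_lintegral_of_nonneg_ae (.of_forall fun x => by positivity)
    (by exact ((continuous_inner_weyl φ χ).norm.pow 2).aestronglyMeasurable)]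
  simp only [ENNReal.ofReal_pow (norm_nonneg _), ofReal_norm]
  rw [lintegral_enorm_inner_weyl_sq, ENNReal.toReal_mul, ENNReal.toReal_mul, ENNReal.toReal_pow,
    ENNReal.toReal_pow, ENNReal.toReal_ofReal Real.two_pi_pos.le, toReal_enorm, toReal_enorm]

theorem integrable_inner_weyl_mul (φ χ χ' φ' : H) :
    Integrable fun x => inner ℂ φ (weyl x χ) * inner ℂ (weyl x χ') φ' :=
  (memLp_inner_weyl φ χ).integrable_mul (memLp_inner_weyl_left φ' χ')

theorem integral_inner_weyl_mul_self (φ χ : H) :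
    ∫ x, inner ℂ φ (weyl x χ) * inner ℂ (weyl x χ) φ =
      2 * Real.pi * (inner ℂ φ φ * inner ℂ χ χ) := by
  have e (x : ℝ × ℝ) : inner ℂ φ (weyl x χ) * inner ℂ (weyl x χ) φ =
      ((‖inner ℂ φ (weyl x χ)‖ ^ 2 : ℝ) : ℂ) := by
    rw [← inner_conj_symm (weyl x χ) φ, Complex.mul_conj, Complex.normSq_eq_norm_sq]
  simp only [e]
  rw [integral_complex_ofReal, integral_norm_inner_weyl_sq]
  simp [inner_self_eq_norm_sq_to_K]

theorem integral_inner_weyl_mul_inner_weyl (φ φ' χ : H) :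
    ∫ x, inner ℂ φ (weyl x χ) * inner ℂ (weyl x χ) φ' =
      2 * Real.pi * (inner ℂ φ φ' * inner ℂ χ χ) := by
  have h := integral_inner_apply_of_self (E := H) (μ := volume)
    (T := fun x : ℝ × ℝ => rankOne ℂ (weyl x χ) (weyl x χ))
    (C := (2 * Real.pi * inner ℂ χ χ : ℂ) • LinearMap.id)
  simp only [ContinuousLinearMap.coe_coe, inner_left_rankOne_apply, LinearMap.smul_apply,
    LinearMap.id_apply, inner_smul_left, map_mul, map_ofNat, conj_ofReal, inner_conj_symm] at h
  rw [h (fun φ => integrable_inner_weyl_mul φ χ χ φ) fun φ => ?_]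
  · ring
  · rw [integral_inner_weyl_mul_self]
    ring

theorem integral_inner_weyl_mul (φ χ χ' φ' : H) :
    ∫ x, inner ℂ φ (weyl x χ) * inner ℂ (weyl x χ') φ' =
      2 * Real.pi * (inner ℂ φ φ' * inner ℂ χ' χ) := by
  have h := integral_inner_apply_of_self (E := H) (μ := volume)
    (T := fun x : ℝ × ℝ => rankOne ℂ (weyl (-x) φ) (weyl (-x) φ'))
    (C := (2 * Real.pi * inner ℂ φ' φ : ℂ) • LinearMap.id)
  simp only [ContinuousLinearMap.coe_coe, inner_left_rankOne_apply, LinearMap.smul_apply,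
    LinearMap.id_apply, inner_smul_left, map_mul, map_ofNat, conj_ofReal, inner_conj_symm,
    ← inner_weyl_left, ← inner_weyl_right, mul_comm (inner ℂ (weyl _ _) _)] at h
  rw [h (fun χ => integrable_inner_weyl_mul φ χ χ φ') fun χ => ?_]
  · ring
  · rw [integral_inner_weyl_mul_inner_weyl]
    ring

theorem integral_norm_inner_weyl_mul_le (φ χ χ' φ' : H) :
    ∫ x, ‖inner ℂ φ (weyl x χ) * inner ℂ (weyl x χ') φ'‖ ≤
      2 * Real.pi * (‖φ‖ * ‖χ‖ * (‖χ'‖ * ‖φ'‖)) := by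
  have h := integral_mul_norm_le_Lp_mul_Lq (μ := volume) Real.HolderConjugate.two_two
    (f := fun x => inner ℂ φ (weyl x χ)) (g := fun x => inner ℂ (weyl x χ') φ')
    (by simpa using memLp_inner_weyl φ χ) (by simpa using memLp_inner_weyl_left φ' χ')
  simp only [norm_mul]
  refine h.trans_eq ?_
  simp only [norm_inner_symm _ φ', Real.rpow_ofNat]
  rw [integral_norm_inner_weyl_sq, integral_norm_inner_weyl_sq, ← Real.sqrt_eq_rpow,
    ← Real.sqrt_eq_rpow, ← Real.sqrt_mul (by positivity), ← Real.sqrt_sq (by positivity :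
      0 ≤ 2 * Real.pi * (‖φ‖ * ‖χ‖ * (‖χ'‖ * ‖φ'‖)))]
  congr 1
  ring

end Orthogonality

/-! ### Orthogonality relations for families of vectors -/

section Family

variable {α : Type*} [MeasurableSpace α] {κ : Measure α} {f g g' f' : α → H}

theorem aestronglyMeasurable_prod_weyl_apply (hg : AEStronglyMeasurable g κ) :
    AEStronglyMeasurable (fun z : (ℝ × ℝ) × α => weyl z.1 (g z.2)) (volume.prod κ) := by
  have hz : AEStronglyMeasurable (fun z : (ℝ × ℝ) × α => (z.1, g z.2)) (volume.prod κ) :=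
    measurable_fst.aestronglyMeasurable.prodMk hg.comp_snd
  have := Continuous.comp_aestronglyMeasurable continuous_uncurry_weyl_apply hz
  exact this

theorem aestronglyMeasurable_prod_inner_weyl_mul (hf : AEStronglyMeasurable f κ)
    (hg : AEStronglyMeasurable g κ) (hg' : AEStronglyMeasurable g' κ)
    (hf' : AEStronglyMeasurable f' κ) :
    AEStronglyMeasurable (fun z : (ℝ × ℝ) × α => inner ℂ (f z.2) (weyl z.1 (g z.2)) *
      inner ℂ (weyl z.1 (g' z.2)) (f' z.2)) (volume.prod κ) := by
  have h₁ := AEStronglyMeasurable.inner (𝕜 := ℂ) (hf.comp_snd (ν := κ) (μ := volume (α := ℝ × ℝ)))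
    (aestronglyMeasurable_prod_weyl_apply hg)
  have h₂ := AEStronglyMeasurable.inner (𝕜 := ℂ) (aestronglyMeasurable_prod_weyl_apply hg')
    (hf'.comp_snd (ν := κ) (μ := volume (α := ℝ × ℝ)))
  exact h₁.mul h₂

variable [SFinite κ]

theorem integrable_prod_inner_weyl_mul (hf : AEStronglyMeasurable f κ)
    (hg : AEStronglyMeasurable g κ) (hg' : AEStronglyMeasurable g' κ)
    (hf' : AEStronglyMeasurable f' κ)
    (h : Integrable (fun t => ‖f t‖ * ‖g t‖ * (‖g' t‖ * ‖f' t‖)) κ) :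
    Integrable (fun z : (ℝ × ℝ) × α => inner ℂ (f z.2) (weyl z.1 (g z.2)) *
      inner ℂ (weyl z.1 (g' z.2)) (f' z.2)) (volume.prod κ) := by
  have hm := aestronglyMeasurable_prod_inner_weyl_mul hf hg hg' hf'
  have hnorm : AEStronglyMeasurable (fun t =>
      ∫ x, ‖inner ℂ (f t) (weyl x (g t)) * inner ℂ (weyl x (g' t)) (f' t)‖) κ := by
    have := hm.norm.prod_swap
    exact this.integral_prod_right'
  have hint : Integrable (fun t =>
      ∫ x, ‖inner ℂ (f t) (weyl x (g t)) * inner ℂ (weyl x (g' t)) (f' t)‖) κ := by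
    refine (h.const_mul (2 * Real.pi)).mono' hnorm (.of_forall fun t => ?_)
    rw [Real.norm_of_nonneg (integral_nonneg fun _ => norm_nonneg _)]
    exact integral_norm_inner_weyl_mul_le _ _ _ _
  exact (integrable_prod_iff' hm).2
    ⟨.of_forall fun t => integrable_inner_weyl_mul (f t) (g t) (g' t) (f' t), hint⟩

variable (hF : Integrable (fun z : (ℝ × ℝ) × α => inner ℂ (f z.2) (weyl z.1 (g z.2)) *
      inner ℂ (weyl z.1 (g' z.2)) (f' z.2)) (volume.prod κ))
include hF

theorem integral_integral_inner_weyl_mul :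
    ∫ x, ∫ t, inner ℂ (f t) (weyl x (g t)) * inner ℂ (weyl x (g' t)) (f' t) ∂κ =
      2 * Real.pi * ∫ t, inner ℂ (f t) (f' t) * inner ℂ (g' t) (g t) ∂κ := by
  rw [integral_integral_swap hF]
  simp only [integral_inner_weyl_mul, integral_const_mul]

theorem integral_norm_integral_inner_weyl_mul_le
    (h : Integrable (fun t => ‖f t‖ * ‖g t‖ * (‖g' t‖ * ‖f' t‖)) κ) :
    ∫ x, ‖∫ t, inner ℂ (f t) (weyl x (g t)) * inner ℂ (weyl x (g' t)) (f' t) ∂κ‖ ≤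
      2 * Real.pi * ∫ t, ‖f t‖ * ‖g t‖ * (‖g' t‖ * ‖f' t‖) ∂κ := by
  calc
    _ ≤ ∫ x, ∫ t, ‖inner ℂ (f t) (weyl x (g t)) * inner ℂ (weyl x (g' t)) (f' t)‖ ∂κ :=
      integral_mono hF.integral_prod_left.norm hF.integral_norm_prod_left
        fun x => norm_integral_le_integral_norm _
    _ = ∫ t, (∫ x, ‖inner ℂ (f t) (weyl x (g t)) * inner ℂ (weyl x (g' t)) (f' t)‖) ∂κ :=
      integral_integral_swap hF.norm
    _ ≤ ∫ t, 2 * Real.pi * (‖f t‖ * ‖g t‖ * (‖g' t‖ * ‖f' t‖)) ∂κ :=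
      integral_mono hF.norm.integral_prod_right (h.const_mul _)
        fun t => integral_norm_inner_weyl_mul_le _ _ _ _
    _ = _ := integral_const_mul _ _

end Family

/-! ### The Weyl transform -/

/-- The Weyl transform (characteristic function) `y ↦ tr[ρ W(y)]` of a trace class operator. -/
def weylTransform (ρ : H →L[ℂ] H) (y : ℝ × ℝ) : ℂ := tr (ρ * weyl y)

section WeylTransform

variable {α : Type*} [MeasurableSpace α] {μ : Measure α} {r : α → H}

theorem weylTransform_mixture (hr : MemLp r 2 μ) (y : ℝ × ℝ) :
    weylTransform (mixture μ r) y = ∫ t, inner ℂ (r t) (weyl y (r t)) ∂μ :=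
  tr_mixture_mul hr _

theorem weylTransform_zero (ρ : H →L[ℂ] H) : weylTransform ρ 0 = tr ρ := by
  rw [weylTransform, weyl_zero, mul_one]

theorem weylTransform_neg_mixture (hr : MemLp r 2 μ) (y : ℝ × ℝ) :
    weylTransform (mixture μ r) (-y) = conj (weylTransform (mixture μ r) y) := by
  rw [weylTransform_mixture hr, weylTransform_mixture hr, ← integral_conj]
  simp only [inner_conj_symm, inner_weyl_left]

theorem continuous_weylTransform_mixture (hr : MemLp r 2 μ) :
    Continuous (weylTransform (mixture μ r)) := by
  rw [funext (weylTransform_mixture hr)]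
  refine continuous_of_dominated (bound := fun t => ‖r t‖ ^ 2)
    (fun y => hr.1.inner ((weyl y).comp_memLp' hr).1)
    (fun y => .of_forall fun t => (norm_inner_weyl_le _ _ _).trans_eq (sq _).symm)
    (hr.integrable_norm_pow two_ne_zero) (.of_forall fun t => continuous_inner_weyl _ _)

theorem integrable_norm_mul_norm_mul (hr : MemLp r 2 μ) (φ ψ : H) :
    Integrable (fun t => ‖φ‖ * ‖r t‖ * (‖r t‖ * ‖ψ‖)) μ := by
  convert (hr.integrable_norm_pow two_ne_zero).const_mul (‖φ‖ * ‖ψ‖) using 2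
  ring

theorem integral_weylTransform_mixture_mul_inner [SFinite μ] (hr : MemLp r 2 μ) (φ ψ : H) :
    ∫ y, weylTransform (mixture μ r) y * inner ℂ (weyl y ψ) φ =
      2 * Real.pi * inner ℂ ψ (mixture μ r φ) := by
  simp only [weylTransform_mixture hr, ← integral_mul_const]
  rw [integral_integral_inner_weyl_mul, inner_mixture hr]
  · simp only [mul_comm (inner ℂ ψ _)]
  · refine integrable_prod_inner_weyl_mul (g' := fun _ => ψ) (f' := fun _ => φ) hr.1 hr.1
      aestronglyMeasurable_const aestronglyMeasurable_const ?_
    convert integrable_norm_mul_norm_mul hr ψ φ using 2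
    ring

end WeylTransform

theorem IsState.weylTransform_zero {ρ : H →L[ℂ] H} (hρ : IsState ρ) : weylTransform ρ 0 = 1 :=
  (TiltedPhaseSpace.weylTransform_zero ρ).trans hρ.2

theorem IsState.weylTransform_neg {ρ : H →L[ℂ] H} (hρ : IsState ρ) (y : ℝ × ℝ) :
    weylTransform ρ (-y) = conj (weylTransform ρ y) := by
  obtain ⟨r, hr, rfl⟩ := hρ.exists_mixture_eq
  exact weylTransform_neg_mixture hr y

theorem IsState.continuous_weylTransform {ρ : H →L[ℂ] H} (hρ : IsState ρ) :
    Continuous (weylTransform ρ) := by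
  obtain ⟨r, hr, rfl⟩ := hρ.exists_mixture_eq
  exact continuous_weylTransform_mixture hr

theorem IsState.eq_of_weylTransform_eq {ρ₁ ρ₂ : H →L[ℂ] H} (h₁ : IsState ρ₁) (h₂ : IsState ρ₂)
    (h : weylTransform ρ₁ = weylTransform ρ₂) : ρ₁ = ρ₂ := by
  obtain ⟨r₁, hr₁, rfl⟩ := h₁.exists_mixture_eq
  obtain ⟨r₂, hr₂, rfl⟩ := h₂.exists_mixture_eq
  refine ContinuousLinearMap.ext fun φ => ext_inner_left ℂ fun ψ => ?_
  refine mul_left_cancel₀ (ofReal_ne_zero.2 Real.two_pi_pos.ne') ?_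
  push_cast
  rw [← integral_weylTransform_mixture_mul_inner hr₁, h,
    integral_weylTransform_mixture_mul_inner hr₂]

/-! ### Orbits of mixtures under the Weyl operators -/

section Orbit

theorem inner_orbit (S : H →L[ℂ] H) (x : ℝ × ℝ) (φ ψ : H) :
    inner ℂ φ (orbit S x ψ) = inner ℂ (weyl (-x) φ) (S (weyl (-x) ψ)) := by
  rw [orbit, adjoint_weyl, mul_apply_eq_comp, mul_apply_eq_comp, inner_weyl_right]

variable {α : Type*} [MeasurableSpace α] {ν : Measure α} {s : α → H}

theorem inner_orbit_mixture (hs : MemLp s 2 ν) (x : ℝ × ℝ) (φ ψ : H) :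
    inner ℂ φ (orbit (mixture ν s) x ψ) =
      ∫ t, inner ℂ φ (weyl x (s t)) * inner ℂ (weyl x (s t)) ψ ∂ν := by
  rw [inner_orbit, inner_mixture hs]
  simp only [inner_weyl_right x, inner_weyl_left x]

theorem phase_mul_inner_weyl (x y : ℝ × ℝ) (φ ψ : H) :
    phase x y * inner ℂ φ (weyl x ψ) = inner ℂ (weyl (-y) φ) (weyl x (weyl (-y) ψ)) := by
  rw [← inner_weyl_right, weyl_conj_weyl_apply, inner_smul_right]

variable [SFinite ν]

theorem integrable_prod_inner_orbit_mixture (hs : MemLp s 2 ν) (φ ψ : H) :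
    Integrable (fun z : (ℝ × ℝ) × α =>
      inner ℂ φ (weyl z.1 (s z.2)) * inner ℂ (weyl z.1 (s z.2)) ψ) (volume.prod ν) :=
  integrable_prod_inner_weyl_mul (f := fun _ => φ) (f' := fun _ => ψ) aestronglyMeasurable_const
    hs.1 hs.1 aestronglyMeasurable_const (integrable_norm_mul_norm_mul hs φ ψ)

theorem integrable_inner_orbit_mixture (hs : MemLp s 2 ν) (φ ψ : H) :
    Integrable fun x => inner ℂ φ (orbit (mixture ν s) x ψ) := by
  simp only [inner_orbit_mixture hs]
  exact (integrable_prod_inner_orbit_mixture hs φ ψ).integral_prod_left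

theorem integral_norm_inner_orbit_mixture_le (hs : MemLp s 2 ν) (φ ψ : H) :
    ∫ x, ‖inner ℂ φ (orbit (mixture ν s) x ψ)‖ ≤
      2 * Real.pi * (‖φ‖ * ‖ψ‖ * ∫ t, ‖s t‖ ^ 2 ∂ν) := by
  simp only [inner_orbit_mixture hs]
  refine (integral_norm_integral_inner_weyl_mul_le (f := fun _ => φ) (f' := fun _ => ψ)
    (integrable_prod_inner_orbit_mixture hs φ ψ)
    (integrable_norm_mul_norm_mul hs φ ψ)).trans_eq ?_
  rw [← integral_const_mul (‖φ‖ * ‖ψ‖)]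
  exact congrArg (2 * Real.pi * ·) (integral_congr_ae (.of_forall fun t => by ring))

theorem integral_phase_mul_inner_orbit_mixture (hs : MemLp s 2 ν) (y : ℝ × ℝ) (φ ψ : H) :
    ∫ x, phase x y * inner ℂ φ (orbit (mixture ν s) x ψ) =
      2 * Real.pi * (inner ℂ φ (weyl y ψ) * weylTransform (mixture ν s) (-y)) := by
  have hs' : MemLp (fun t => weyl (-y) (s t)) 2 ν := (weyl (-y)).comp_memLp' hs
  have hi : Integrable (fun t => ‖weyl (-y) φ‖ * ‖weyl (-y) (s t)‖ * (‖s t‖ * ‖ψ‖)) ν := by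
    simpa only [norm_weyl_apply] using integrable_norm_mul_norm_mul hs φ ψ
  have hF := integrable_prod_inner_weyl_mul (f := fun _ => weyl (-y) φ) (f' := fun _ => ψ)
    aestronglyMeasurable_const hs'.1 hs.1 aestronglyMeasurable_const hi
  have h := integral_integral_inner_weyl_mul (f := fun _ => weyl (-y) φ)
    (g := fun t => weyl (-y) (s t)) (g' := s) (f' := fun _ => ψ) hF
  rw [integral_const_mul, ← weylTransform_mixture hs, ← inner_weyl_right] at h
  simp only [inner_orbit_mixture hs, ← integral_const_mul, ← mul_assoc, phase_mul_inner_weyl]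
  rw [h]
  ring

end Orbit

/-! ### Weak integrals -/

theorem exists_hasWeakIntegral {F : ℝ × ℝ → (H →L[ℂ] H)} {Z : Set (ℝ × ℝ)} {C : ℝ}
    (hi : ∀ φ ψ : H, IntegrableOn (fun x => inner ℂ φ (F x ψ)) Z)
    (hC : ∀ φ ψ : H, ‖∫ x in Z, inner ℂ φ (F x ψ)‖ ≤ C * ‖φ‖ * ‖ψ‖) :
    ∃ T, HasWeakIntegral F Z T := by
  let D : H →ₗ⋆[ℂ] H →ₗ[ℂ] ℂ := LinearMap.mk₂'ₛₗ _ _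
    (fun φ ψ => ∫ x in Z, inner ℂ φ (F x ψ))
    (fun φ φ' ψ => by
      simp only [inner_add_left]
      exact integral_add (hi _ _) (hi _ _))
    (fun c φ ψ => by
      simp only [inner_smul_left]
      exact integral_const_mul _ _)
    (fun φ ψ ψ' => by
      simp only [map_add, inner_add_right]
      exact integral_add (hi _ _) (hi _ _))
    (fun c φ ψ => by
      simp only [map_smul, inner_smul_right]
      exact integral_const_mul _ _)
  refine ⟨ContinuousLinearMap.adjoint
    (InnerProductSpace.continuousLinearMapOfBilin (D.mkContinuous₂ C hC)),
    fun φ ψ => ⟨hi φ ψ, ?_⟩⟩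
  rw [ContinuousLinearMap.adjoint_inner_right, InnerProductSpace.continuousLinearMapOfBilin_apply]
  rfl

theorem HasWeakIntegral.weakIntegral_eq {F : ℝ × ℝ → (H →L[ℂ] H)} {Z : Set (ℝ × ℝ)}
    {T : H →L[ℂ] H} (h : HasWeakIntegral F Z T) : weakIntegral F Z = T := by
  have hex : ∃ T, HasWeakIntegral F Z T := ⟨T, h⟩
  rw [weakIntegral, dif_pos hex]
  refine ContinuousLinearMap.ext fun ψ => ext_inner_left ℂ fun φ => ?_
  rw [(hex.choose_spec φ ψ).2, (h φ ψ).2]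

/-! ### The phase space observable of a state -/

section PhaseSpaceObservable

variable {S : H →L[ℂ] H}

theorem IsState.integrable_inner_orbit (hS : IsState S) (φ ψ : H) :
    Integrable fun x => inner ℂ φ (orbit S x ψ) := by
  obtain ⟨s, hs, rfl⟩ := hS.exists_mixture_eq
  exact integrable_inner_orbit_mixture hs φ ψ

theorem IsState.integral_norm_inner_orbit_le (hS : IsState S) (φ ψ : H) :
    ∫ x, ‖inner ℂ φ (orbit S x ψ)‖ ≤ 2 * Real.pi * ‖φ‖ * ‖ψ‖ := by
  obtain ⟨s, hs, rfl⟩ := hS.exists_mixture_eq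
  refine (integral_norm_inner_orbit_mixture_le hs φ ψ).trans_eq ?_
  rw [(isState_mixture_iff hs).1 hS, mul_one, mul_assoc (2 * Real.pi)]

theorem IsState.integral_phase_mul_inner_orbit (hS : IsState S) (y : ℝ × ℝ) (φ ψ : H) :
    ∫ x, phase x y * inner ℂ φ (orbit S x ψ) =
      2 * Real.pi * (inner ℂ φ (weyl y ψ) * weylTransform S (-y)) := by
  obtain ⟨s, hs, rfl⟩ := hS.exists_mixture_eq
  exact integral_phase_mul_inner_orbit_mixture hs y φ ψ

theorem IsState.integral_inner_orbit (hS : IsState S) (φ ψ : H) :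
    ∫ x, inner ℂ φ (orbit S x ψ) = 2 * Real.pi * inner ℂ φ ψ := by
  simpa [phase_zero, weyl_zero, hS.weylTransform_zero] using
    hS.integral_phase_mul_inner_orbit 0 φ ψ

theorem inner_orbit_self_nonneg (hS : S.IsPositive) (x : ℝ × ℝ) (φ : H) :
    0 ≤ inner ℂ φ (orbit S x φ) :=
  (hS.conj_adjoint (weyl x)).inner_nonneg_right φ

theorem IsState.exists_hasWeakIntegral_orbit (hS : IsState S) (Z : Set (ℝ × ℝ)) :
    ∃ T, HasWeakIntegral (orbit S) Z T := by
  refine exists_hasWeakIntegral (C := 2 * Real.pi)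
    (fun φ ψ => (hS.integrable_inner_orbit φ ψ).integrableOn) fun φ ψ => ?_
  exact (norm_integral_le_integral_norm _).trans <|
    (setIntegral_le_integral (hS.integrable_inner_orbit φ ψ).norm
      (.of_forall fun x => norm_nonneg _)).trans (hS.integral_norm_inner_orbit_le φ ψ)

theorem IsState.inner_G (hS : IsState S) (Z : Set (ℝ × ℝ)) (φ ψ : H) :
    inner ℂ φ (G S Z ψ) = ((1 / (2 * Real.pi) : ℝ) : ℂ) * ∫ x in Z, inner ℂ φ (orbit S x ψ) := by
  obtain ⟨T, hT⟩ := hS.exists_hasWeakIntegral_orbit Z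
  rw [G, hT.weakIntegral_eq, smul_apply, inner_smul_right, (hT φ ψ).2]

theorem IsState.isObservable_G (hS : IsState S) : IsObservable (G S) := by
  refine ⟨fun Z _ => isPositive_of_forall_inner_nonneg fun φ => ?_,
    ContinuousLinearMap.ext fun ψ => ext_inner_left ℂ fun φ => ?_, fun Z hZ hd φ ψ => ?_⟩
  · rw [hS.inner_G]
    exact mul_nonneg (Complex.zero_le_real.2 (by positivity))
      (integral_nonneg fun x => inner_orbit_self_nonneg hS.1 x φ)
  · rw [hS.inner_G, Measure.restrict_univ, hS.integral_inner_orbit, one_apply_eq_self]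
    push_cast
    field_simp
  · simp only [hS.inner_G]
    exact (hasSum_integral_iUnion hZ hd (hS.integrable_inner_orbit φ ψ).integrableOn).mul_left _

end PhaseSpaceObservable

/-! ### Measurable maps of the outcome space -/

section OutcomeMap

variable {E F : Set (ℝ × ℝ) → (H →L[ℂ] H)}

theorem IsObservable.preimage (hE : IsObservable E) {f : ℝ × ℝ → ℝ × ℝ} (hf : Measurable f) :
    IsObservable fun Z => E (f ⁻¹' Z) := by
  refine ⟨fun Z hZ => hE.isPositive _ (hf hZ), hE.univ, fun Z hZ hd φ ψ => ?_⟩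
  simp only [Set.preimage_iUnion]
  exact hE.iUnion _ (fun n => hf (hZ n)) (fun m n hmn => (hd hmn).preimage f) φ ψ

theorem informationallyEquivalent_preimage (E : Set (ℝ × ℝ) → (H →L[ℂ] H))
    (f : (ℝ × ℝ) ≃ᵐ (ℝ × ℝ)) : InformationallyEquivalent E fun Z => E (f ⁻¹' Z) := by
  refine fun ρ₁ ρ₂ _ _ => ⟨fun h Z hZ => h _ (f.measurable hZ), fun h Z hZ => ?_⟩
  simpa only [← Set.preimage_comp, f.symm_comp_self, Set.preimage_id] using
    h (f.symm ⁻¹' Z) (f.symm.measurable hZ)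

theorem InformationallyEquivalent.informationallyComplete_iff (h : InformationallyEquivalent E F) :
    InformationallyComplete E ↔ InformationallyComplete F :=
  forall₄_congr fun ρ₁ ρ₂ h₁ h₂ => imp_congr_left (h ρ₁ ρ₂ h₁ h₂)

end OutcomeMap

/-! ### Linear changes of variables -/

section LinearChange

variable {E F : Type*} [NormedAddCommGroup E] [NormedSpace ℝ E] [FiniteDimensional ℝ E]
  [MeasurableSpace E] [BorelSpace E] (μ : Measure E) [μ.IsAddHaarMeasure]
  [NormedAddCommGroup F] (L : E ≃ₗ[ℝ] E)

theorem map_linearEquiv_addHaar :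
    μ.map L = ENNReal.ofReal |(LinearMap.det (L : E →ₗ[ℝ] E))⁻¹| • μ :=
  Measure.map_linearMap_addHaar_eq_smul_addHaar μ L.isUnit_det'.ne_zero

theorem measurableEmbedding_linearEquiv : MeasurableEmbedding L :=
  L.toContinuousLinearEquiv.toHomeomorph.measurableEmbedding

theorem setIntegral_comp_linearEquiv_symm [NormedSpace ℝ F] (g : E → F) (Z : Set E) :
    ∫ x in Z, g (L.symm x) ∂μ =
      |LinearMap.det (L : E →ₗ[ℝ] E)| • ∫ x in L ⁻¹' Z, g x ∂μ := by
  have h := (measurableEmbedding_linearEquiv L).setIntegral_map (μ := μ)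
    (fun x => g (L.symm x)) Z
  simp only [LinearEquiv.symm_apply_apply] at h
  rw [← h, map_linearEquiv_addHaar, Measure.restrict_smul, integral_smul_measure,
    ENNReal.toReal_ofReal (abs_nonneg _), smul_smul, ← abs_mul,
    mul_inv_cancel₀ L.isUnit_det'.ne_zero, abs_one, one_smul]

variable {μ}

theorem integrableOn_comp_linearEquiv_symm {g : E → F} {Z : Set E}
    (hg : IntegrableOn g (L ⁻¹' Z) μ) : IntegrableOn (fun x => g (L.symm x)) Z μ := by
  have h : IntegrableOn (fun x => g (L.symm x)) Z (μ.map L) := by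
    rw [(measurableEmbedding_linearEquiv L).integrableOn_map_iff]
    simpa only [Function.comp_def, LinearEquiv.symm_apply_apply] using hg
  rw [map_linearEquiv_addHaar, IntegrableOn, Measure.restrict_smul] at h
  exact (integrable_smul_measure (by simpa using L.isUnit_det'.ne_zero) ENNReal.ofReal_ne_top).1 h

end LinearChange

theorem HasWeakIntegral.comp_linearEquiv_symm {F : ℝ × ℝ → (H →L[ℂ] H)} {Z : Set (ℝ × ℝ)}
    {T : H →L[ℂ] H} (L : (ℝ × ℝ) ≃ₗ[ℝ] (ℝ × ℝ)) (h : HasWeakIntegral F (L ⁻¹' Z) T) :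
    HasWeakIntegral (fun x => F (L.symm x)) Z
      (((|LinearMap.det (L : (ℝ × ℝ) →ₗ[ℝ] (ℝ × ℝ))| : ℝ) : ℂ) • T) := fun φ ψ => by
  refine ⟨integrableOn_comp_linearEquiv_symm L (h φ ψ).1, ?_⟩
  rw [smul_apply, inner_smul_right, (h φ ψ).2]
  exact (setIntegral_comp_linearEquiv_symm volume L fun x => inner ℂ φ (F x ψ)) Z |>.symm

/-! ### The tilted observable -/

section Tilt

variable {θ : ℝ} (hθ : θ ∈ Set.Ioo (-Real.pi) 0 ∪ Set.Ioo 0 Real.pi)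

theorem det_tilt : LinearMap.det (tilt θ hθ : (ℝ × ℝ) →ₗ[ℝ] (ℝ × ℝ)) = Real.sin θ := by
  rw [← LinearMap.det_toMatrix (Module.Basis.finTwoProd ℝ), Matrix.det_fin_two]
  simp [LinearMap.toMatrix_apply, tilt]

theorem IsState.exists_hasWeakIntegral_tiltedOrbit {S : H →L[ℂ] H} (hS : IsState S)
    (Z : Set (ℝ × ℝ)) : ∃ T, HasWeakIntegral (tiltedOrbit θ hθ S) Z T :=
  let ⟨_, hT⟩ := hS.exists_hasWeakIntegral_orbit (tilt θ hθ ⁻¹' Z)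
  ⟨_, hT.comp_linearEquiv_symm (tilt θ hθ)⟩

theorem IsState.tiltedG_eq {S : H →L[ℂ] H} (hS : IsState S) :
    tiltedG θ hθ S = fun Z => G S (tilt θ hθ ⁻¹' Z) := by
  funext Z
  obtain ⟨T, hT⟩ := hS.exists_hasWeakIntegral_orbit (tilt θ hθ ⁻¹' Z)
  have hT' : HasWeakIntegral (tiltedOrbit θ hθ S) Z (((|Real.sin θ| : ℝ) : ℂ) • T) := by
    rw [← det_tilt hθ]
    exact hT.comp_linearEquiv_symm (tilt θ hθ)
  have hsin : |Real.sin θ| ≠ 0 := abs_ne_zero.2 (sin_ne_zero hθ)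
  rw [tiltedG, G, hT'.weakIntegral_eq, hT.weakIntegral_eq, smul_smul, ← ofReal_mul]
  congr 2
  field_simp

end Tilt

/-! ### Measurement outcome densities -/

/-- The probability density of the outcomes of `G S` in the state `ρ`. -/
def outcomeDensity (S ρ : H →L[ℂ] H) (x : ℝ × ℝ) : ℝ := (tr (ρ * orbit S x)).re / (2 * Real.pi)

section OutcomeDensity

variable {S ρ : H →L[ℂ] H}

theorem aestronglyMeasurable_prod_inner_orbit_self {α : Type*} [MeasurableSpace α]
    {μ : Measure α} [SFinite μ] {r : α → H} (S : H →L[ℂ] H) (hr : AEStronglyMeasurable r μ) :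
    AEStronglyMeasurable (fun z : (ℝ × ℝ) × α => inner ℂ (r z.2) (orbit S z.1 (r z.2)))
      (volume.prod μ) := by
  have hcont : Continuous fun z : (ℝ × ℝ) × H => weyl (-z.1) z.2 := by
    have := Continuous.comp continuous_uncurry_weyl_apply
      (Continuous.prodMk (continuous_fst (X := ℝ × ℝ) (Y := H)).neg continuous_snd)
    exact this
  have hz : AEStronglyMeasurable (fun z : (ℝ × ℝ) × α => (z.1, r z.2)) (volume.prod μ) :=
    measurable_fst.aestronglyMeasurable.prodMk hr.comp_snd
  have hw := Continuous.comp_aestronglyMeasurable hcont hz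
  have hSw := Continuous.comp_aestronglyMeasurable S.continuous hw
  simp only [inner_orbit]
  exact AEStronglyMeasurable.inner (𝕜 := ℂ) hw hSw

theorem IsState.integrable_prod_inner_orbit_self {α : Type*} [MeasurableSpace α] {μ : Measure α}
    [SFinite μ] {r : α → H} (hS : IsState S) (hr : MemLp r 2 μ) :
    Integrable (fun z : (ℝ × ℝ) × α => inner ℂ (r z.2) (orbit S z.1 (r z.2)))
      (volume.prod μ) := by
  have hm := aestronglyMeasurable_prod_inner_orbit_self S hr.1
  have hnorm : AEStronglyMeasurable (fun t => ∫ x, ‖inner ℂ (r t) (orbit S x (r t))‖) μ := by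
    have := hm.norm.prod_swap
    exact this.integral_prod_right'
  have hint : Integrable (fun t => ∫ x, ‖inner ℂ (r t) (orbit S x (r t))‖) μ := by
    refine ((hr.integrable_norm_pow two_ne_zero).const_mul (2 * Real.pi)).mono' hnorm
      (.of_forall fun t => ?_)
    rw [Real.norm_of_nonneg (integral_nonneg fun _ => norm_nonneg _), sq, ← mul_assoc]
    exact hS.integral_norm_inner_orbit_le (r t) (r t)
  exact (integrable_prod_iff' hm).2
    ⟨.of_forall fun t => hS.integrable_inner_orbit (r t) (r t), hint⟩

theorem IsState.tr_mul_orbit_nonneg (hρ : IsState ρ) (hS : S.IsPositive) (x : ℝ × ℝ) :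
    0 ≤ tr (ρ * orbit S x) := by
  obtain ⟨r, hr, rfl⟩ := hρ.exists_mixture_eq
  rw [tr_mixture_mul hr]
  exact integral_nonneg fun t => inner_orbit_self_nonneg hS x (r t)

theorem IsState.ofReal_outcomeDensity (hρ : IsState ρ) (hS : S.IsPositive) (x : ℝ × ℝ) :
    (outcomeDensity S ρ x : ℂ) = tr (ρ * orbit S x) / (2 * Real.pi) := by
  have h : ((tr (ρ * orbit S x)).re : ℂ) = tr (ρ * orbit S x) :=
    Complex.ext rfl (Complex.nonneg_iff.1 (hρ.tr_mul_orbit_nonneg hS x)).2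
  rw [outcomeDensity, ofReal_div, h]
  push_cast
  rfl

theorem IsState.outcomeDensity_nonneg (hρ : IsState ρ) (hS : S.IsPositive) :
    0 ≤ outcomeDensity S ρ := fun x =>
  div_nonneg (Complex.nonneg_iff.1 (hρ.tr_mul_orbit_nonneg hS x)).1 Real.two_pi_pos.le

theorem IsState.integrable_outcomeDensity (hS : IsState S) (hρ : IsState ρ) :
    Integrable (outcomeDensity S ρ) := by
  obtain ⟨r, hr, rfl⟩ := hρ.exists_mixture_eq
  refine Integrable.div_const ?_ _
  simp only [tr_mixture_mul hr]
  exact (hS.integrable_prod_inner_orbit_self hr).integral_prod_left.re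

theorem IsState.tr_mul_G (hS : IsState S) (hρ : IsState ρ) (Z : Set (ℝ × ℝ)) :
    tr (ρ * G S Z) = (∫ x in Z, outcomeDensity S ρ x : ℝ) := by
  simp only [← integral_complex_ofReal, hρ.ofReal_outcomeDensity hS.1]
  obtain ⟨r, hr, rfl⟩ := hρ.exists_mixture_eq
  have hF : Integrable (Function.uncurry fun x t => inner ℂ (r t) (orbit S x (r t)))
      ((volume.restrict Z).prod Measure.count) :=
    (hS.integrable_prod_inner_orbit_self hr).mono_measure
      (Measure.prod_mono Measure.restrict_le_self le_rfl)
  rw [integral_div, tr_mixture_mul hr]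
  simp only [tr_mixture_mul hr, hS.inner_G, integral_const_mul]
  rw [integral_integral_swap hF]
  push_cast
  ring

theorem IsState.integral_phase_mul_outcomeDensity (hS : IsState S) (hρ : IsState ρ)
    (y : ℝ × ℝ) : ∫ x, phase x y * outcomeDensity S ρ x =
      weylTransform ρ y * weylTransform S (-y) := by
  simp only [hρ.ofReal_outcomeDensity hS.1]
  obtain ⟨r, hr, rfl⟩ := hρ.exists_mixture_eq
  have hF : Integrable (Function.uncurry fun x t => phase x y * inner ℂ (r t) (orbit S x (r t)))
      (volume.prod Measure.count) :=
    (hS.integrable_prod_inner_orbit_self hr).bdd_mul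
      (continuous_phase y).aestronglyMeasurable.comp_fst
      (.of_forall fun z => (norm_phase z.1 y).le)
  simp only [tr_mixture_mul hr, ← mul_div_assoc, integral_div, ← integral_const_mul]
  rw [integral_integral_swap hF]
  simp only [hS.integral_phase_mul_inner_orbit, integral_const_mul, integral_mul_const]
  rw [← weylTransform_mixture hr]
  field_simp

end OutcomeDensity

/-! ### The symplectic Fourier transform determines densities -/

section SymplecticFourier

theorem phase_eq_exp (L : StrongDual ℝ (ℝ × ℝ)) (x : ℝ × ℝ) :
    phase x (-L (0, 1), L (1, 0)) = exp (L x * I) := by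
  have hx : L x = x.1 * L (1, 0) + x.2 * L (0, 1) := by
    conv_lhs => rw [show x = x.1 • ((1, 0) : ℝ × ℝ) + x.2 • ((0, 1) : ℝ × ℝ) by ext <;> simp]
    simp only [map_add, map_smul, smul_eq_mul]
  rw [phase, hx, mul_comm I]
  congr 3
  ring

theorem integral_withDensity_ofReal {f : ℝ × ℝ → ℝ} (hf : AEMeasurable f) (hf0 : 0 ≤ f)
    (g : ℝ × ℝ → ℂ) :
    ∫ x, g x ∂volume.withDensity (fun x => ENNReal.ofReal (f x)) = ∫ x, g x * f x := by
  rw [integral_withDensity_eq_integral_toReal_smul₀ hf.ennreal_ofReal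
    (.of_forall fun x => ENNReal.ofReal_lt_top)]
  simp only [ENNReal.toReal_ofReal (hf0 _), real_smul, mul_comm]

theorem charFunDual_withDensity_ofReal {f : ℝ × ℝ → ℝ} (hf : AEMeasurable f) (hf0 : 0 ≤ f)
    (L : StrongDual ℝ (ℝ × ℝ)) :
    charFunDual (volume.withDensity fun x => ENNReal.ofReal (f x)) L =
      ∫ x, phase x (-L (0, 1), L (1, 0)) * f x := by
  simp only [charFunDual_apply, ← phase_eq_exp, integral_withDensity_ofReal hf hf0]

theorem ae_eq_of_integral_phase_mul_eq {f g : ℝ × ℝ → ℝ} (hf : Integrable f) (hg : Integrable g)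
    (hf0 : 0 ≤ f) (hg0 : 0 ≤ g)
    (h : ∀ y, ∫ x, phase x y * f x = ∫ x, phase x y * g x) : f =ᵐ[volume] g := by
  have := isFiniteMeasure_withDensity_ofReal hf.2
  have := isFiniteMeasure_withDensity_ofReal hg.2
  have hμ : volume.withDensity (fun x => ENNReal.ofReal (f x)) =
      volume.withDensity fun x => ENNReal.ofReal (g x) :=
    Measure.ext_of_charFunDual <| funext fun L => by
      rw [charFunDual_withDensity_ofReal hf.1.aemeasurable hf0,
        charFunDual_withDensity_ofReal hg.1.aemeasurable hg0, h]
  rw [withDensity_eq_iff_of_sigmaFinite hf.1.aemeasurable.ennreal_ofReal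
    hg.1.aemeasurable.ennreal_ofReal] at hμ
  filter_upwards [hμ] with x hx
  exact (ENNReal.ofReal_eq_ofReal_iff (hf0 x) (hg0 x)).1 hx

end SymplecticFourier

theorem IsState.sameStatistics_G_iff {S ρ₁ ρ₂ : H →L[ℂ] H} (hS : IsState S) (h₁ : IsState ρ₁)
    (h₂ : IsState ρ₂) : SameStatistics (G S) ρ₁ ρ₂ ↔ ∀ y,
      weylTransform ρ₁ y * weylTransform S (-y) = weylTransform ρ₂ y * weylTransform S (-y) := by
  simp only [SameStatistics, hS.tr_mul_G h₁, hS.tr_mul_G h₂, ofReal_inj,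
    ← hS.integral_phase_mul_outcomeDensity h₁, ← hS.integral_phase_mul_outcomeDensity h₂]
  have hi₁ := hS.integrable_outcomeDensity h₁
  have hi₂ := hS.integrable_outcomeDensity h₂
  refine ⟨fun h y => ?_, fun h Z _ => ?_⟩
  · have hae := hi₁.ae_eq_of_forall_setIntegral_eq _ _ hi₂ fun Z hZ _ => h Z hZ
    exact integral_congr_ae (hae.mono fun x hx => by simp only [hx])
  · have hae := ae_eq_of_integral_phase_mul_eq hi₁ hi₂ (h₁.outcomeDensity_nonneg hS.1)
      (h₂.outcomeDensity_nonneg hS.1) h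
    exact integral_congr_ae (ae_restrict_of_ae hae)

/-! ### Dense support implies completeness -/

theorem IsState.informationallyComplete_G_of_dense {S : H →L[ℂ] H} (hS : IsState S)
    (hd : Dense (Function.support (weylTransform S))) : InformationallyComplete (G S) := by
  intro ρ₁ ρ₂ h₁ h₂ hstat
  refine h₁.eq_of_weylTransform_eq h₂ <|
    h₁.continuous_weylTransform.ext_on hd h₂.continuous_weylTransform fun y hy => ?_
  have hy' : weylTransform S (-y) ≠ 0 := by
    rw [hS.weylTransform_neg]
    exact (map_ne_zero _).2 hy
  exact mul_right_cancel₀ hy' ((hS.sameStatistics_G_iff h₁ h₂).1 hstat y)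

/-! ### Randomly displaced pure states -/

/-- The pure state of the vector `φ` after a displacement `W(x)` that is random with density
`f` in `x`. -/
def displacedMixture (f : ℝ × ℝ → ℝ) (φ : H) : H →L[ℂ] H :=
  mixture (volume.withDensity fun x => ENNReal.ofReal (f x)) fun x => weyl x φ

theorem integrable_phase_mul {f : ℝ × ℝ → ℂ} (hf : Integrable f) (y : ℝ × ℝ) :
    Integrable fun x => phase x y * f x :=
  hf.bdd_mul (continuous_phase y).aestronglyMeasurable
    (.of_forall fun x => (norm_phase x y).le)

section DisplacedMixture

variable {f : ℝ × ℝ → ℝ}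

theorem memLp_weyl_apply (μ : Measure (ℝ × ℝ)) [IsFiniteMeasure μ] (φ : H) :
    MemLp (fun x => weyl x φ) 2 μ :=
  .of_bound (continuous_weyl_apply φ).aestronglyMeasurable ‖φ‖
    (.of_forall fun x => (norm_weyl_apply x φ).le)

theorem weylTransform_displacedMixture (hf : Integrable f) (hf0 : 0 ≤ f) (φ : H) (y : ℝ × ℝ) :
    weylTransform (displacedMixture f φ) y =
      (∫ x, phase x y * f x) * inner ℂ φ (weyl y φ) := by
  have := isFiniteMeasure_withDensity_ofReal hf.2
  have hconj (x : ℝ × ℝ) :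
      inner ℂ (weyl x φ) (weyl y (weyl x φ)) = phase x y * inner ℂ φ (weyl y φ) := by
    have hphase : phase y (-x) = phase x y := by
      rw [phase, phase]
      congr 3
      simp only [Prod.fst_neg, Prod.snd_neg]
      ring
    have h := weyl_conj_weyl_apply y (-x) φ
    rw [neg_neg, hphase] at h
    rw [inner_weyl_left, h, inner_smul_right]
  rw [displacedMixture, weylTransform_mixture (memLp_weyl_apply _ φ)]
  simp only [hconj]
  rw [integral_mul_const, integral_withDensity_ofReal hf.1.aemeasurable hf0]

theorem isState_displacedMixture (hf : Integrable f) (hf0 : 0 ≤ f) (hf1 : ∫ x, f x = 1) {φ : H}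
    (hφ : ‖φ‖ = 1) : IsState (displacedMixture f φ) := by
  have := isFiniteMeasure_withDensity_ofReal hf.2
  refine ⟨isPositive_mixture (memLp_weyl_apply _ φ), ?_⟩
  rw [← weylTransform_zero, weylTransform_displacedMixture hf hf0]
  simp only [phase_zero, one_mul, weyl_zero, one_apply_eq_self, inner_self_eq_norm_sq_to_K, hφ,
    integral_complex_ofReal, hf1]
  norm_num

theorem exists_weylTransform_sub_eq (hf : Integrable f) (hf0 : ∫ x, f x = 0)
    (hf1 : ∫ x, |f x| ≠ 0) {φ : H} (hφ : ‖φ‖ = 1) :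
    ∃ ρ₁ ρ₂, IsState ρ₁ ∧ IsState ρ₂ ∧ ∃ c : ℂ, c ≠ 0 ∧ ∀ y,
      weylTransform ρ₁ y - weylTransform ρ₂ y =
        c * (∫ x, phase x y * f x) * inner ℂ φ (weyl y φ) := by
  -- The states are random displacements of `φ` with densities proportional to `|f| ± f`.
  set m := ∫ x, |f x|
  have hm : 0 ≤ m := integral_nonneg fun x => abs_nonneg _
  have hi₁ : Integrable fun x => (|f x| + f x) / m := (hf.abs.add hf).div_const m
  have hi₂ : Integrable fun x => (|f x| - f x) / m := (hf.abs.sub hf).div_const m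
  have hn₁ : 0 ≤ fun x => (|f x| + f x) / m := fun x =>
    div_nonneg (by linarith [neg_abs_le (f x)]) hm
  have hn₂ : 0 ≤ fun x => (|f x| - f x) / m := fun x =>
    div_nonneg (by linarith [le_abs_self (f x)]) hm
  refine ⟨displacedMixture (fun x => (|f x| + f x) / m) φ,
    displacedMixture (fun x => (|f x| - f x) / m) φ,
    isState_displacedMixture hi₁ hn₁ ?_ hφ, isState_displacedMixture hi₂ hn₂ ?_ hφ,
    2 / m, div_ne_zero two_ne_zero (ofReal_ne_zero.2 hf1), fun y => ?_⟩
  · rw [integral_div, integral_add hf.abs hf, hf0, add_zero, div_self hf1]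
  · rw [integral_div, integral_sub hf.abs hf, hf0, sub_zero, div_self hf1]
  · have hp₁ : Integrable fun x => phase x y * (((|f x| + f x) / m : ℝ) : ℂ) :=
      integrable_phase_mul hi₁.ofReal y
    have hp₂ : Integrable fun x => phase x y * (((|f x| - f x) / m : ℝ) : ℂ) :=
      integrable_phase_mul hi₂.ofReal y
    rw [weylTransform_displacedMixture hi₁ hn₁, weylTransform_displacedMixture hi₂ hn₂, ← sub_mul,
      ← integral_sub hp₁ hp₂, ← integral_const_mul]
    congr 2 with x
    push_cast
    ring

end DisplacedMixture

/-! ### Integrable functions with localized symplectic Fourier transform -/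

section Localized

open FourierTransform SchwartzMap

theorem integral_exp_mul_fourierInv (k : 𝓢(ℝ, ℂ)) (y : ℝ) :
    ∫ t : ℝ, exp (I * ((t * y : ℝ) : ℂ)) * (𝓕⁻ k : 𝓢(ℝ, ℂ)) t = k (-(2 * Real.pi)⁻¹ * y) := by
  have hk : 𝓕 (𝓕⁻ k) = k := fourier_fourierInv_eq k
  have h := congrArg (fun f : 𝓢(ℝ, ℂ) => f (-(2 * Real.pi)⁻¹ * y)) hk
  simp only [SchwartzMap.fourier_coe, Real.fourier_real_eq_integral_exp_smul] at h
  rw [← h]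
  congr 1 with t
  rw [smul_eq_mul, mul_comm I,
    show -2 * Real.pi * t * (-(2 * Real.pi)⁻¹ * y) = t * y by field_simp]

theorem exists_integrable_integral_exp_mul_eq_bump {c : ℝ} (g : ContDiffBump c) :
    ∃ u : ℝ → ℂ, Integrable u ∧ ∀ y : ℝ, ∫ t, exp (I * ((t * y : ℝ) : ℂ)) * u t = g y := by
  have hπ : -(2 * Real.pi) ≠ 0 := by simp [Real.pi_ne_zero]
  have hsupp : HasCompactSupport fun ξ : ℝ => ((g (-(2 * Real.pi) * ξ) : ℝ) : ℂ) := by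
    have := g.hasCompactSupport.comp_homeomorph (Homeomorph.mulLeft₀ _ hπ)
    exact this.comp_left (g := ((↑) : ℝ → ℂ)) ofReal_zero
  have hsmooth : ContDiff ℝ (⊤ : ℕ∞) fun ξ : ℝ => ((g (-(2 * Real.pi) * ξ) : ℝ) : ℂ) :=
    Complex.ofRealCLM.contDiff.comp (g.contDiff.comp (by fun_prop))
  let k : 𝓢(ℝ, ℂ) := hsupp.toSchwartzMap hsmooth
  have hk (y : ℝ) : k (-(2 * Real.pi)⁻¹ * y) = g y := by
    change ((g (-(2 * Real.pi) * (-(2 * Real.pi)⁻¹ * y)) : ℝ) : ℂ) = g y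
    congr 2
    field_simp
  exact ⟨(𝓕⁻ k : 𝓢(ℝ, ℂ)), (𝓕⁻ k : 𝓢(ℝ, ℂ)).integrable,
    fun y => (integral_exp_mul_fourierInv k y).trans (hk y)⟩

theorem exists_integrable_integral_phase_mul_eq (y₀ : ℝ × ℝ) {ε : ℝ} (hε : 0 < ε) :
    ∃ (f : ℝ × ℝ → ℂ) (g : ℝ × ℝ → ℝ), Integrable f ∧ 0 ≤ g ∧ g y₀ = 1 ∧
      Function.support g ⊆ Metric.ball y₀ ε ∧ ∀ y, ∫ x, phase x y * f x = g y := by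
  let g (c : ℝ) : ContDiffBump c := ⟨ε / 2, ε, half_pos hε, half_lt_self hε⟩
  have hg1 (c : ℝ) : g c c = 1 :=
    (g c).one_of_mem_closedBall (Metric.mem_closedBall_self (half_pos hε).le)
  obtain ⟨u, hu, hug⟩ := exists_integrable_integral_exp_mul_eq_bump (g y₀.2)
  obtain ⟨v, hv, hvg⟩ := exists_integrable_integral_exp_mul_eq_bump (g (-y₀.1))
  refine ⟨fun x => u x.1 * v x.2, fun y => g y₀.2 y.2 * g (-y₀.1) (-y.1), hu.mul_prod hv,
    fun y => mul_nonneg (g _).nonneg (g _).nonneg, by simp only [hg1, mul_one],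
    fun y hy => ?_, fun y => ?_⟩
  · have h₂ : y.2 ∈ Metric.ball y₀.2 ε := by
      rw [← (g y₀.2).support_eq]
      exact left_ne_zero_of_mul hy
    have h₁ : -y.1 ∈ Metric.ball (-y₀.1) ε := by
      rw [← (g (-y₀.1)).support_eq]
      exact right_ne_zero_of_mul hy
    rw [Metric.mem_ball, dist_neg_neg] at h₁
    exact max_lt h₁ h₂
  · rw [ofReal_mul, ← hug, ← hvg, ← integral_prod_mul, Measure.volume_eq_prod]
    congr 1 with x
    rw [mul_mul_mul_comm, ← Complex.exp_add, phase]
    congr 2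
    push_cast
    ring

theorem integral_phase_mul_re {f : ℝ × ℝ → ℂ} (hf : Integrable f) (y : ℝ × ℝ) :
    ∫ x, phase x y * (f x).re =
      ((∫ x, phase x y * f x) + conj (∫ x, phase x (-y) * f x)) / 2 := by
  have hconj : Integrable fun x => conj (phase x (-y) * f x) :=
    (Complex.conjCLE : ℂ →L[ℝ] ℂ).integrable_comp (integrable_phase_mul hf (-y))
  rw [← integral_conj, ← integral_add (integrable_phase_mul hf y) hconj, ← integral_div]
  congr 1 with x
  rw [Complex.re_eq_add_conj, map_mul, conj_phase, neg_neg]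
  ring

end Localized

/-! ### Completeness implies dense support -/

theorem IsState.weyl_ne_zero {ρ : H →L[ℂ] H} (hρ : IsState ρ) (y : ℝ × ℝ) : weyl y ≠ 0 := by
  intro h
  have hzero (φ : H) : φ = 0 := by
    rw [← norm_eq_zero, ← norm_weyl_apply y, h, zero_apply, norm_zero]
  refine one_ne_zero (hρ.2.symm.trans ?_)
  simp only [tr, hzero (ρ _), inner_zero_right, tsum_zero]

theorem IsState.not_informationallyComplete_G {S : H →L[ℂ] H} (hS : IsState S) {w : ℝ × ℝ → ℝ}
    (hw : Integrable w) (h : ∀ y, (∫ x, phase x y * w x) * weylTransform S (-y) = 0)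
    {y₀ : ℝ × ℝ} (hy₀ : ∫ x, phase x y₀ * w x ≠ 0) : ¬ InformationallyComplete (G S) := by
  intro hcomplete
  have hw0 : ∫ x, w x = 0 := by
    have h0 := h 0
    simp only [neg_zero, hS.weylTransform_zero, mul_one, phase_zero, one_mul,
      integral_complex_ofReal] at h0
    exact_mod_cast h0
  have hw1 : ∫ x, |w x| ≠ 0 := fun h1 => hy₀ <| integral_eq_zero_of_ae <| by
    filter_upwards [(integral_eq_zero_iff_of_nonneg (fun x => abs_nonneg (w x)) hw.abs).1 h1]
      with x hx
    rw [abs_eq_zero.1 hx, ofReal_zero, mul_zero, Pi.zero_apply]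
  obtain ⟨φ, hφ, hφy⟩ := exists_norm_eq_one_inner_apply_ne_zero (T := (weyl y₀ : H →ₗ[ℂ] H))
    fun h₀ => hS.weyl_ne_zero y₀ (ContinuousLinearMap.coe_injective h₀)
  obtain ⟨ρ₁, ρ₂, h₁, h₂, c, hc, hsub⟩ := exists_weylTransform_sub_eq hw hw0 hw1 hφ
  have hstat : SameStatistics (G S) ρ₁ ρ₂ := (hS.sameStatistics_G_iff h₁ h₂).2 fun y => by
    rw [← sub_eq_zero, ← sub_mul, hsub]
    linear_combination (c * inner ℂ φ (weyl y φ)) * h y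
  have hzero := hsub y₀
  rw [hcomplete ρ₁ ρ₂ h₁ h₂ hstat, sub_self] at hzero
  exact mul_ne_zero (mul_ne_zero hc hy₀) hφy hzero.symm

theorem IsState.tsupport_weylTransform_eq_univ {S : H →L[ℂ] H} (hS : IsState S)
    (hcomplete : InformationallyComplete (G S)) : tsupport (weylTransform S) = Set.univ := by
  by_contra hne
  obtain ⟨y₀, hy₀⟩ := (Set.ne_univ_iff_exists_notMem _).1 hne
  obtain ⟨ε, hε, hball⟩ := Metric.isOpen_iff.1 (isClosed_tsupport _).isOpen_compl y₀ hy₀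
  have hzero {y : ℝ × ℝ} (hy : y ∈ Metric.ball y₀ ε) : weylTransform S y = 0 :=
    image_eq_zero_of_notMem_tsupport (hball hy)
  obtain ⟨f, g, hf, hg0, hg1, hgs, hfg⟩ := exists_integrable_integral_phase_mul_eq y₀ hε
  have hre (y : ℝ × ℝ) : ∫ x, phase x y * (f x).re = ((g y + g (-y)) / 2 : ℝ) := by
    rw [integral_phase_mul_re hf, hfg, hfg, conj_ofReal]
    push_cast
    rfl
  refine hS.not_informationallyComplete_G hf.re (y₀ := y₀) (fun y => ?_) ?_ hcomplete
  · refine (congrArg (· * weylTransform S (-y)) (hre y)).trans ?_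
    by_cases hy : g y = 0
    · by_cases hy' : g (-y) = 0
      · simp [hy, hy']
      · simp [hzero (hgs hy')]
    · simp [hS.weylTransform_neg, hzero (hgs hy)]
  · refine (hre y₀).trans_ne (ofReal_ne_zero.2 ?_)
    have hg : 0 ≤ g (-y₀) := hg0 (-y₀)
    rw [hg1]
    positivity

theorem IsState.informationallyComplete_G_iff {S : H →L[ℂ] H} (hS : IsState S) :
    InformationallyComplete (G S) ↔ tsupport (fun x => tr (S * weyl x)) = Set.univ :=
  ⟨hS.tsupport_weylTransform_eq_univ,
    fun h => hS.informationallyComplete_G_of_dense (dense_iff_closure_eq.2 h)⟩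

end TiltedPhaseSpace

end

theorem mainTheorem4 (θ : ℝ) (hθ : θ ∈ Set.Ioo (-Real.pi) 0 ∪ Set.Ioo 0 Real.pi)
    (S : TiltedPhaseSpace.H →L[ℂ] TiltedPhaseSpace.H) (hS : TiltedPhaseSpace.IsState S) :
    -- the defining operator integrals exist, and they define observables
    (∀ Z : Set (ℝ × ℝ), MeasurableSet Z →
      (∃ T, TiltedPhaseSpace.HasWeakIntegral (TiltedPhaseSpace.orbit S) Z T) ∧
      (∃ T, TiltedPhaseSpace.HasWeakIntegral (TiltedPhaseSpace.tiltedOrbit θ hθ S) Z T)) ∧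
    TiltedPhaseSpace.IsObservable (TiltedPhaseSpace.G S) ∧
    TiltedPhaseSpace.IsObservable (TiltedPhaseSpace.tiltedG θ hθ S) ∧
    -- `G^S_θ(Z) = G^S(f_θ⁻¹(Z))` for all Borel sets `Z`
    (∀ Z : Set (ℝ × ℝ), MeasurableSet Z →
      TiltedPhaseSpace.tiltedG θ hθ S Z
        = TiltedPhaseSpace.G S (TiltedPhaseSpace.tilt θ hθ ⁻¹' Z)) ∧
    -- informational equivalence
    TiltedPhaseSpace.InformationallyEquivalent
      (TiltedPhaseSpace.G S) (TiltedPhaseSpace.tiltedG θ hθ S) ∧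
    -- informational completeness
    (TiltedPhaseSpace.InformationallyComplete (TiltedPhaseSpace.tiltedG θ hθ S) ↔
      tsupport (fun x : ℝ × ℝ => TiltedPhaseSpace.tr (S * TiltedPhaseSpace.weyl x))
        = Set.univ) := by
  let f : ℝ × ℝ ≃ᵐ ℝ × ℝ :=
    (TiltedPhaseSpace.tilt θ hθ).toContinuousLinearEquiv.toHomeomorph.toMeasurableEquiv
  have htilt : TiltedPhaseSpace.tiltedG θ hθ S = fun Z => TiltedPhaseSpace.G S (f ⁻¹' Z) :=
    hS.tiltedG_eq hθ
  have hequiv : TiltedPhaseSpace.InformationallyEquivalent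
      (TiltedPhaseSpace.G S) (TiltedPhaseSpace.tiltedG θ hθ S) := by
    rw [htilt]
    exact TiltedPhaseSpace.informationallyEquivalent_preimage (TiltedPhaseSpace.G S) f
  have hobs : TiltedPhaseSpace.IsObservable (TiltedPhaseSpace.tiltedG θ hθ S) := by
    rw [htilt]
    exact hS.isObservable_G.preimage f.measurable
  exact ⟨fun Z _ => ⟨hS.exists_hasWeakIntegral_orbit Z,
      hS.exists_hasWeakIntegral_tiltedOrbit hθ Z⟩,
    hS.isObservable_G, hobs, fun Z _ => congrFun htilt Z, hequiv,
    hequiv.informationallyComplete_iff.symm.trans hS.informationallyComplete_G_iff⟩
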